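/- Let $P^+$ be a probability measure on $\mathcal X\times\mathcal A$ with marginals $P_{\mathcal X},P_{\mathcal A}$, absolutely continuous with respect to $P_{\mathcal X}\otimes P_{\mathcal A}$ with density $r(x,a)=\frac{P^+(x,a)}{P_{\mathcal X}(x)P_{\mathcal A}(a)}$. Let $k_X^+(x,x')=\int r(x,a)r(x',a)\,dP_{\mathcal A}(a)$ be the dual kernel, let $\kappa\ge 0$ be given by $\kappa^2=\operatorname{ess\,sup}_{x\sim P_{\mathcal X}}k_X^+(x,x)$ (the context complexity), assumed finite, and let $$k(x,x')=k_X^+(x,x')-\int k_X^+(z,x')\,dP_{\mathcal X}(z)-\int k_X^+(x,z')\,dP_{\mathcal X}(z')+\iint k_X^+(z,z')\,dP_{\mathcal X}(z)\,dP_{\mathcal X}(z')$$ be the centered kernel of $k_X^+$. Let $s_1^2\ge s_2^2\ge\cdots\ge 0$ (with $s_i\ge 0$) be the eigenvalues, counted with multiplicity, of the integral operator $T_kf=\int f(x')k(\cdot,x')\,dP_{\mathcal X}(x')$ on $L^2(P_{\mathcal X})$, where the list of nonzero eigenvalues is continued by zeros if it is finite, and let $\mu_i$ (for $s_i>0$)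 be corresponding orthonormal eigenfunctions. Let $\mathcal H_k=\{\sum_i s_iu_i\mu_i:\sum_i u_i^2<\infty\}\subseteq L^2(P_{\mathcal X})$ with inner product $\langle\sum_i u_i\mu_i,\sum_i v_i\mu_i\rangle_{\mathcal H_k}=\sum_i u_iv_i/s_i^2$ (sums over $s_i>0$). For $f\in L^2(P_{\mathcal X})$ write $\tilde f=f-\mathbb E_{P_{\mathcal X}}[f]$, and for $0<\epsilon<1$ let $$\mathcal F_{\mathcal H_k}=\{f\in\mathcal H_k:\ \|\tilde f\|_{\mathcal H_k}\ge\|\tilde f\|_{P_{\mathcal X}}\ge(1-\epsilon)\|\tilde f\|_{\mathcal H_k}\},$$ where $\|\cdot\|_{P_{\mathcal X}}$ is the norm of $L^2(P_{\mathcal X})$. Let $m\ge 1$ and $0\le d\le m$, let $x_1,\dots,x_m$ be i.i.d. samples from $P_{\mathcal X}$, and let $G=(k(x_i,x_j))_{i,j}$ be their Gram matrix, with eigenvalues $\lambda_1\ge\cdots\ge\lambda_m$ and orthonormal eigenvectors $v_1,\dots,v_m$. If $\lambda_i>0$ for all $i\le d$, let $\Phi=[\phi_1,\dots,\phi_d]$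 with $\phi_i(x)=\lambda_i^{-1/2}\sum_{j=1}^m v_i[j]\,k(x,x_j)$. Suppose $(1-\epsilon)^2<s_1^2$, let $\delta\in(0,1)$, put $\eta=\frac{\kappa^2}{\sqrt m}\bigl(2\sqrt d+3\sqrt{\log(6/\delta)}\bigr)$, and suppose $s_1^2-s_{d+1}^2-\eta>0$. Then with probability at least $1-\delta$ over the samples the following holds, provided $\lambda_i>0$ for all $i\le d$, for every choice of the eigenvectors: $\phi_1,\dots,\phi_d\in\mathcal H_k$, and every $f^*\in\mathcal F_{\mathcal H_k}$ has a unique $\mathcal H_k$-orthogonal projection $f_\Phi$ onto $\operatorname{span}(\phi_1,\dots,\phi_d)$, which satisfies $$\|f^*-f_\Phi\|_{\mathcal H_k}^2\le\frac{s_1^2-(1-\epsilon)^2+s_1\sqrt{s_{d+1}^2+\eta}}{s_1^2-s_{d+1}^2-\eta}\cdot\frac{\|f^*\|_{P_{\mathcal X}}^2}{(1-\epsilon)^2},$$ $$\|f^*-f_\Phi\|_{P_{\mathcal X}}^2\le\frac{s_1^2-(1-\epsilon)^2+s_1\sqrt{s_{d+1}^2+\eta}}{s_1^2-s_{d+1}^2-\eta}\cdot\frac{s_1^2\,\|f^*\|_{P_{\mathcal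 X}}^2}{(1-\epsilon)^2}.$$ -/

import Mathlib

open MeasureTheory

open scoped ENNReal

noncomputable section

namespace Contexture

variable {X A : Type*} [MeasurableSpace X] [MeasurableSpace A]

/-- The density `P⁺(x,a) / (P_X(x) P_A(a))` of a joint law `P` on `X × A` with respect to the
product `P_X ⊗ P_A` of its marginals; it equals `P⁺(a|x) / P_A(a)`. -/
def jointDensity (P : Measure (X × A)) (x : X) (a : A) : ℝ≥0∞ :=
  P.rnDeriv (P.fst.prod P.snd) (x, a)

/-- The dual kernel `k_X⁺(x,x') = ∫ P⁺(a|x) P⁺(a|x') / P_A(a) da` of the context `P`. -/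
def dualKernel (P : Measure (X × A)) (x x' : X) : ℝ :=
  ∫ a, (jointDensity P x a).toReal * (jointDensity P x' a).toReal ∂P.snd

/-- The context complexity `κ`: `κ²` is the `P_X`-essential supremum of
`k_X⁺(x,x) = D_χ²(P⁺(·|x) ‖ P_A) + 1`, computed in `[0,∞]` so that no integrability is needed. -/
def contextComplexity (P : Measure (X × A)) : ℝ≥0∞ :=
  (essSup (fun x => ∫⁻ a, jointDensity P x a ^ 2 ∂P.snd) P.fst) ^ (1 / 2 : ℝ)

/-- The centered kernel of `k` with respect to `ν`. -/
def centeredKernel (ν : Measure X) (k : X → X → ℝ) (x x' : X) : ℝ :=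
  k x x' - (∫ z, k z x' ∂ν) - (∫ z', k x z' ∂ν) + ∫ z, ∫ z', k z z' ∂ν ∂ν

/-- The integral operator `T_k`, as an operation on functions. -/
def integralOperator (ν : Measure X) (k : X → X → ℝ) (f : X → ℝ) (x : X) : ℝ :=
  ∫ x', f x' * k x x' ∂ν

/-- `f ∈ L²(ν)` satisfies `T_k f = c f` in `L²(ν)`. -/
def IsEigenfunction (ν : Measure X) (k : X → X → ℝ) (c : ℝ) (f : Lp ℝ 2 ν) : Prop :=
  integralOperator ν k f =ᵐ[ν] fun x => c * f x

/-- `s 0 ≥ s 1 ≥ ⋯ ≥ 0` and `μ 0, μ 1, …` list the eigenvalues `(s i)²` of `T_k`, with multiplicity,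
and corresponding orthonormal eigenfunctions. Indices start at `0`, so `s i` is the `(i+1)`-st value.
If `T_k` has finite rank the list of nonzero eigenvalues is continued by zeros, and nothing
is asked of `μ i` where `s i = 0`. -/
structure IsEigensystem (ν : Measure X) (k : X → X → ℝ) (s : ℕ → ℝ) (μ : ℕ → Lp ℝ 2 ν) :
    Prop where
  nonneg : ∀ i, 0 ≤ s i
  antitone : Antitone s
  orthonormal : Orthonormal ℝ fun i : {i : ℕ // s i ≠ 0} => μ i
  eigen : ∀ i, s i ≠ 0 → IsEigenfunction ν k (s i ^ 2) (μ i)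
  /-- no eigenfunction of a nonzero eigenvalue is left out -/
  exhaustive : ∀ (c : ℝ) (f : Lp ℝ 2 ν), c ≠ 0 → IsEigenfunction ν k c f →
    (∀ i, s i ≠ 0 → inner ℝ (μ i) f = 0) → f = 0

/-- The induced RKHS `H_k = {∑ sᵢ uᵢ μᵢ : ∑ uᵢ² < ∞} ⊆ L²(ν)`. -/
def inducedRKHS {ν : Measure X} (s : ℕ → ℝ) (μ : ℕ → Lp ℝ 2 ν) : Set (Lp ℝ 2 ν) :=
  {f | ∃ u : ℕ → ℝ, Summable (fun i => u i ^ 2) ∧ HasSum (fun i => (s i * u i) • μ i) f}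

/-- The inner product `⟨∑ uᵢ μᵢ, ∑ vᵢ μᵢ⟩ = ∑ uᵢ vᵢ / sᵢ²` of `H_k`; terms with `sᵢ = 0` are `0`. -/
def hkInner {ν : Measure X} (s : ℕ → ℝ) (μ : ℕ → Lp ℝ 2 ν) (f g : Lp ℝ 2 ν) : ℝ :=
  ∑' i, inner ℝ (μ i) f * inner ℝ (μ i) g / s i ^ 2

/-- The norm of `H_k`. -/
def hkNorm {ν : Measure X} (s : ℕ → ℝ) (μ : ℕ → Lp ℝ 2 ν) (f : Lp ℝ 2 ν) : ℝ :=
  Real.sqrt (hkInner s μ f f)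

/-- The centered version `f - 𝔼 f` of `f`. -/
def centered {ν : Measure X} [IsProbabilityMeasure ν] (f : Lp ℝ 2 ν) : Lp ℝ 2 ν :=
  f - (memLp_const (∫ x, f x ∂ν)).toLp (fun _ : X => ∫ x, f x ∂ν)

/-- The functions that are `(1-ε)`-compatible with `H_k`. -/
def compatibleClass {ν : Measure X} [IsProbabilityMeasure ν] (s : ℕ → ℝ) (μ : ℕ → Lp ℝ 2 ν)
    (ε : ℝ) : Set (Lp ℝ 2 ν) :=
  {f | f ∈ inducedRKHS s μ ∧ ‖centered f‖ ≤ hkNorm s μ (centered f) ∧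
    (1 - ε) * hkNorm s μ (centered f) ≤ ‖centered f‖}

/-- The Gram matrix `G[i,j] = k(xᵢ, xⱼ)`. -/
def gramMatrix {m : ℕ} (k : X → X → ℝ) (x : Fin m → X) : Matrix (Fin m) (Fin m) ℝ :=
  Matrix.of fun i j => k (x i) (x j)

/-- `lam` lists the eigenvalues of `G` in nonincreasing order, with orthonormal eigenvectors `v`. -/
structure IsEigendecomposition {m : ℕ} (G : Matrix (Fin m) (Fin m) ℝ) (lam : Fin m → ℝ)
    (v : Fin m → EuclideanSpace ℝ (Fin m)) : Prop where
  antitone : Antitone lam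
  orthonormal : Orthonormal ℝ v
  eigen : ∀ i, G.mulVec (v i).ofLp = lam i • (v i).ofLp

/-- The empirical top-`d` eigenfunctions `φᵢ(y) = λᵢ^{-1/2} ∑ⱼ vᵢ[j] k(y, xⱼ)` of kernel PCA. -/
def kpcaEncoder {m d : ℕ} (hdm : d ≤ m) (k : X → X → ℝ) (x : Fin m → X) (lam : Fin m → ℝ)
    (v : Fin m → EuclideanSpace ℝ (Fin m)) (i : Fin d) (y : X) : ℝ :=
  (1 / Real.sqrt (lam (Fin.castLE hdm i))) * ∑ j, v (Fin.castLE hdm i) j * k y (x j)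

/-- The span of `Φ = [φ₁, …, φ_d]`, as a set of elements of `L²(ν)`. -/
def encoderSpan {ν : Measure X} {d : ℕ} (Φ : Fin d → X → ℝ) : Set (Lp ℝ 2 ν) :=
  {g | ∃ w : Fin d → ℝ, g =ᵐ[ν] fun y => ∑ i, w i * Φ i y}

/-- `g` is the `H_k`-orthogonal projection of `f` onto the span of `Φ`. -/
def IsHkProjection {ν : Measure X} {d : ℕ} (s : ℕ → ℝ) (μ : ℕ → Lp ℝ 2 ν) (Φ : Fin d → X → ℝ)
    (f g : Lp ℝ 2 ν) : Prop :=
  g ∈ encoderSpan Φ ∧ ∀ h ∈ encoderSpan Φ, hkInner s μ (f - g) h = 0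

/-- The deviation term `κ² (2 √d + 3 √(log (6/δ))) / √m`. -/
def deviation (κ : ℝ) (d m : ℕ) (δ : ℝ) : ℝ :=
  κ ^ 2 / Real.sqrt m * (2 * Real.sqrt d + 3 * Real.sqrt (Real.log (6 / δ)))

end Contexture

end

/-!
The map `φ : x ↦ P⁺(·|x) / P_A - 1 ∈ L²(P_A)` is a feature map of the centered kernel, bounded by
`κ`. Hence `T_k = D D*` for the compact operator `D g = ⟪φ ·, g⟫`, whose restriction `F` to
`(ker D)ᗮ` maps that space isometrically onto `H_k` and sends an orthonormal basis `eᵢ` to `sᵢ μᵢ`.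
The encoders are the images under `F` of the normalized eigenvectors `pᵢ` of the empirical
covariance of the features of the sample.

By the Ky Fan principle the `pᵢ` capture at least as much empirical energy as the top `d` basis
vectors `eᵢ`. The energy captured by an orthonormal family is linear in the tensor square `φ ⊗ φ`,
so that its excess over the energy captured by the `eᵢ` deviates from its mean by at most `η`
uniformly over all families: a variance computation bounds the expected supremum, and the McDiarmid
inequality controls the fluctuation around it. Therefore `∑ ‖F pᵢ‖² ≥ ∑ sᵢ² - η`, and the Ky Fan
principle applied to the `pᵢ` and one more unit vector gives `‖F h‖² ≤ (s_{d+1}² + η) ‖h‖²` for all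
`h` orthogonal to the `pᵢ`.

Finally let `f = F u` with `‖F u‖ ≥ (1 - ε) ‖u‖`, and let `a`, `b` be the norms of the components of
`u` in the span of the `pᵢ` and orthogonal to it. Then `a² + b² = ‖u‖²` and
`(1 - ε) ‖u‖ ≤ s₁ a + √(s_{d+1}² + η) b`, which bounds `b`.
-/

noncomputable section

namespace Contexture

open ProbabilityTheory

open scoped NNReal

lemma hasSubgaussianMGF_prod_add {α β : Type*} [MeasurableSpace α] [MeasurableSpace β]
    {ν : Measure α} {ρ : Measure β} [SFinite ν] [SFinite ρ] {f : α → ℝ} {g : α × β → ℝ} {a b : ℝ≥0}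
    (hf : HasSubgaussianMGF f a ν) (hg : Measurable g)
    (hgb : ∀ x, HasSubgaussianMGF (fun y => g (x, y)) b ρ) :
    HasSubgaussianMGF (fun z => f z.1 + g z) (a + b) (ν.prod ρ) := by
  have hmgf (t : ℝ) (x : α) :
      ∫ y, Real.exp (t * (f x + g (x, y))) ∂ρ ≤ Real.exp (t * f x) * Real.exp (b * t ^ 2 / 2) := by
    simp_rw [mul_add, Real.exp_add, integral_const_mul]
    exact mul_le_mul_of_nonneg_left ((hgb x).mgf_le t) (Real.exp_nonneg _)
  have hint (t : ℝ) : Integrable (fun z => Real.exp (t * (f z.1 + g z))) (ν.prod ρ) := by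
    have hm : AEStronglyMeasurable (fun z => Real.exp (t * (f z.1 + g z))) (ν.prod ρ) :=
      (((hf.aestronglyMeasurable.comp_fst).add hg.aestronglyMeasurable).aemeasurable.const_mul
        t).exp.aestronglyMeasurable
    refine (integrable_prod_iff hm).2 ⟨.of_forall fun x => ?_, ?_⟩
    · simp_rw [mul_add, Real.exp_add]
      exact ((hgb x).integrable_exp_mul t).const_mul _
    · refine ((hf.integrable_exp_mul t).mul_const (Real.exp (b * t ^ 2 / 2))).mono'
        hm.norm.integral_prod_right' (.of_forall fun x => ?_)
      simp only [Real.norm_eq_abs, Real.abs_exp]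
      rw [abs_of_nonneg (integral_nonneg fun _ => Real.exp_nonneg _)]
      exact hmgf t x
  refine ⟨hint, fun t => ?_⟩
  calc mgf (fun z => f z.1 + g z) (ν.prod ρ) t
      = ∫ x, ∫ y, Real.exp (t * (f x + g (x, y))) ∂ρ ∂ν := integral_prod _ (hint t)
    _ ≤ ∫ x, Real.exp (t * f x) * Real.exp (b * t ^ 2 / 2) ∂ν :=
        integral_mono (hint t).integral_prod_left ((hf.integrable_exp_mul t).mul_const _) (hmgf t)
    _ = mgf f ν t * Real.exp (b * t ^ 2 / 2) := integral_mul_const _ _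
    _ ≤ Real.exp (a * t ^ 2 / 2) * Real.exp (b * t ^ 2 / 2) := by gcongr; exact hf.mgf_le t
    _ = Real.exp ((a + b : ℝ≥0) * t ^ 2 / 2) := by rw [← Real.exp_add]; push_cast; ring_nf

lemma hasSubgaussianMGF_sub_integral_of_forall_sub_le {α : Type*} [MeasurableSpace α]
    {ν : Measure α} [IsProbabilityMeasure ν] {f : α → ℝ} {c : ℝ≥0} (hf : AEMeasurable f ν)
    (hfc : ∀ x y, f y - f x ≤ c) :
    HasSubgaussianMGF (fun x => f x - ∫ y, f y ∂ν) ((c / 2) ^ 2) ν := by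
  obtain ⟨x₀⟩ := nonempty_of_isProbabilityMeasure ν
  have hbdd : BddBelow (Set.range f) :=
    ⟨f x₀ - c, Set.forall_mem_range.2 fun x => by linarith [hfc x x₀]⟩
  have : Nonempty α := ⟨x₀⟩
  have h := hasSubgaussianMGF_of_mem_Icc (a := ⨅ x, f x) (b := (⨅ x, f x) + c) hf
    (.of_forall fun y => ⟨ciInf_le hbdd y,
      by linarith [le_ciInf fun x => (sub_le_comm.1 (hfc x y) : f y - c ≤ f x)]⟩)
  simpa using h

lemma hasSubgaussianMGF_prod_sub_integral {α β : Type*} [MeasurableSpace α] [MeasurableSpace β]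
    {ν : Measure α} {ρ : Measure β} [IsProbabilityMeasure ν] [IsProbabilityMeasure ρ]
    {g : α × β → ℝ} {b c : ℝ≥0} (hg : Measurable g) (hgc : ∀ x x' y, g (x', y) - g (x, y) ≤ c)
    (hgb : ∀ x, HasSubgaussianMGF (fun y => g (x, y) - ∫ y', g (x, y') ∂ρ) b ρ) :
    HasSubgaussianMGF (fun z => g z - ∫ z', g z' ∂ν.prod ρ) ((c / 2) ^ 2 + b) (ν.prod ρ) := by
  set h : α → ℝ := fun x => ∫ y, g (x, y) ∂ρ
  have hg_int (x : α) : Integrable (fun y => g (x, y)) ρ :=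
    integrable_add_const_iff.1 ((hgb x).integrable.congr (.of_forall fun _ => sub_eq_add_neg _ _))
  have hh : Measurable h := hg.stronglyMeasurable.integral_prod_right'.measurable
  have hhc (x x' : α) : h x' - h x ≤ c := by
    rw [← integral_sub (hg_int x') (hg_int x)]
    calc ∫ y, (g (x', y) - g (x, y)) ∂ρ ≤ ∫ _, (c : ℝ) ∂ρ :=
          integral_mono ((hg_int x').sub (hg_int x)) (integrable_const _) (hgc x x')
      _ = c := by simp
  have hsum : HasSubgaussianMGF (fun z => g z - ∫ x, h x ∂ν) ((c / 2) ^ 2 + b) (ν.prod ρ) := by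
    simpa using hasSubgaussianMGF_prod_add (g := fun z => g z - h z.1)
      (hasSubgaussianMGF_sub_integral_of_forall_sub_le hh.aemeasurable hhc)
      (hg.sub (hh.comp measurable_fst)) hgb
  rwa [integral_prod _ (integrable_add_const_iff.1
    (hsum.integrable.congr (.of_forall fun _ => sub_eq_add_neg _ _)))]

theorem hasSubgaussianMGF_sub_integral_pi_of_bounded_differences {n : ℕ} {Ω : Fin n → Type*}
    [∀ i, MeasurableSpace (Ω i)] (ν : ∀ i, Measure (Ω i)) [∀ i, IsProbabilityMeasure (ν i)]
    {g : (∀ i, Ω i) → ℝ} (hg : Measurable g) {c : Fin n → ℝ≥0}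
    (hgc : ∀ x i y, g (Function.update x i y) - g x ≤ c i) :
    HasSubgaussianMGF (fun x => g x - ∫ y, g y ∂Measure.pi ν) (∑ i, (c i / 2) ^ 2)
      (Measure.pi ν) := by
  induction n with
  | zero =>
    have hconst (x : ∀ i, Ω i) : g x = g default := congrArg g (Subsingleton.elim _ _)
    simp [hconst]
  | succ n ih =>
    have he := measurePreserving_piFinSuccAbove ν 0
    have hG := hg.comp (MeasurableEquiv.piFinSuccAbove Ω 0).symm.measurable
    have hprod := hasSubgaussianMGF_prod_sub_integral (ν := ν 0) hG (c := c 0)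
      (fun a b y => by
        have := hgc (Fin.insertNth 0 a y) 0 b
        rwa [Fin.update_insertNth] at this)
      (fun a => ih (fun j => ν (Fin.succAbove 0 j)) (hG.comp measurable_prodMk_left) fun y i b => by
        have := hgc (Fin.insertNth 0 a y) (Fin.succAbove 0 i) b
        rwa [← Fin.insertNth_update] at this)
    have hmean := he.symm.integral_comp' g
    rw [← he.map_eq] at hprod
    rw [Fin.sum_univ_succAbove _ 0, ← hmean, ← he.map_eq]
    convert hprod.of_map he.measurable.aemeasurable using 2 with x
    exact congrArg (g · - _) ((MeasurableEquiv.piFinSuccAbove Ω 0).symm_apply_apply x).symm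

lemma exists_measurableSet_forall_lt_of_hasSubgaussianMGF {Ω : Type*} [MeasurableSpace Ω]
    {ρ : Measure Ω} [IsProbabilityMeasure ρ] {Z : Ω → ℝ} {v : ℝ≥0} (hZ : HasSubgaussianMGF Z v ρ)
    {ε : ℝ} (hε : 0 ≤ ε) :
    ∃ S, MeasurableSet S ∧ ENNReal.ofReal (1 - Real.exp (-ε ^ 2 / (2 * v))) ≤ ρ S ∧
      ∀ ω ∈ S, Z ω < ε := by
  have hm := measurableSet_toMeasurable ρ {ω | ε ≤ Z ω}
  refine ⟨(toMeasurable ρ {ω | ε ≤ Z ω})ᶜ, hm.compl, ?_, fun ω hω =>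
    lt_of_not_ge fun h => hω (subset_toMeasurable _ _ h)⟩
  rw [← ofReal_measureReal, probReal_compl_eq_one_sub hm, measureReal_def, measure_toMeasurable,
    ← measureReal_def]
  exact ENNReal.ofReal_le_ofReal (sub_le_sub_left (hZ.measure_ge_le hε) 1)

section SupportFunction

variable {H I : Type*} [NormedAddCommGroup H] [InnerProductSpace ℝ H] {B : I → H} {b : ℝ}

/-- The support function `y ↦ supᵢ ⟪B i, y⟫` of a family `B` of vectors; it is meaningful when the
family is norm bounded, the supremum of an unbounded set of reals being `0`. -/
def supportFunction (B : I → H) (y : H) : ℝ := ⨆ i, inner ℝ (B i) y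

lemma inner_le_supportFunction (hB : ∀ i, ‖B i‖ ≤ b) (i : I) (y : H) :
    inner ℝ (B i) y ≤ supportFunction B y :=
  le_ciSup (f := fun i => inner ℝ (B i) y)
    ⟨b * ‖y‖, Set.forall_mem_range.2 fun i =>
      (real_inner_le_norm _ _).trans (by gcongr; exact hB i)⟩ i

variable [Nonempty I]

lemma supportFunction_add_le (hB : ∀ i, ‖B i‖ ≤ b) {y z : H} {c : ℝ}
    (hz : ∀ i, inner ℝ (B i) z ≤ c) : supportFunction B (y + z) ≤ supportFunction B y + c :=
  ciSup_le fun i => by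
    rw [inner_add_right]
    exact add_le_add (inner_le_supportFunction hB i y) (hz i)

lemma lipschitzWith_supportFunction (hB : ∀ i, ‖B i‖ ≤ b) :
    LipschitzWith b.toNNReal (supportFunction B) := by
  have hb : 0 ≤ b := (norm_nonneg _).trans (hB (Classical.arbitrary I))
  refine .of_le_add_mul _ fun y z => ?_
  rw [Real.coe_toNNReal _ hb, dist_eq_norm, ← add_sub_cancel z y, add_sub_cancel_left]
  exact supportFunction_add_le hB fun i =>
    (real_inner_le_norm _ _).trans (by gcongr; exact hB i)

lemma abs_supportFunction_le (hB : ∀ i, ‖B i‖ ≤ b) (y : H) : |supportFunction B y| ≤ b * ‖y‖ := by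
  have hb : 0 ≤ b := (norm_nonneg _).trans (hB (Classical.arbitrary I))
  simpa [supportFunction, hb] using (lipschitzWith_supportFunction hB).dist_le_mul y 0

end SupportFunction

section EmpiricalMean

variable {X H : Type*} [NormedAddCommGroup H] [InnerProductSpace ℝ H] {n : ℕ}

/-- The empirical mean `n⁻¹ ∑ⱼ Y (xⱼ)` of a vector-valued function over a sample. -/
def empiricalMean (Y : X → H) (x : Fin n → X) : H := (n : ℝ)⁻¹ • ∑ j, Y (x j)

lemma empiricalMean_update (Y : X → H) (x : Fin n → X) (i : Fin n) (y : X) :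
    empiricalMean Y (Function.update x i y) =
      empiricalMean Y x + (n : ℝ)⁻¹ • (Y y - Y (x i)) := by
  rw [empiricalMean, empiricalMean, ← smul_add, ← Finset.add_sum_erase _ _ (Finset.mem_univ i),
    ← Finset.add_sum_erase (a := i) _ (fun j => Y (x j)) (Finset.mem_univ i), Function.update_self,
    Finset.sum_congr rfl fun j hj => by rw [Function.update_of_ne (Finset.ne_of_mem_erase hj)]]
  congr 1
  abel

variable [MeasurableSpace X]

lemma memLp_empiricalMean {ν : Measure X} [IsProbabilityMeasure ν] {Y : X → H} {p : ℝ≥0∞}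
    (hY : MemLp Y p ν) : MemLp (empiricalMean (n := n) Y) p (Measure.pi fun _ => ν) :=
  (memLp_finsetSum _ fun j _ =>
    hY.comp_measurePreserving (measurePreserving_eval (fun _ : Fin n => ν) j)).const_smul _

variable {ν : Measure X} [IsProbabilityMeasure ν] {I : Type*} {B : I → H} {b : ℝ} {Y : X → H}

lemma hasSubgaussianMGF_supportFunction_empiricalMean_sub [Nonempty I] (hY : StronglyMeasurable Y)
    (hB : ∀ i, ‖B i‖ ≤ b) {c : ℝ≥0} (hosc : ∀ i x y, inner ℝ (B i) (Y x - Y y) ≤ c) (M : H) :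
    HasSubgaussianMGF
      (fun x : Fin n → X => supportFunction B (empiricalMean Y x - M) -
        ∫ z : Fin n → X, supportFunction B (empiricalMean Y z - M) ∂(Measure.pi fun _ => ν))
      (∑ _ : Fin n, (c / n / 2) ^ 2) (Measure.pi fun _ => ν) := by
  have hmean : StronglyMeasurable fun x : Fin n → X => empiricalMean Y x - M :=
    ((Finset.stronglyMeasurable_fun_sum _ fun j _ =>
      hY.comp_measurable (measurable_pi_apply j)).const_smul _).sub stronglyMeasurable_const
  refine hasSubgaussianMGF_sub_integral_pi_of_bounded_differences _
    ((lipschitzWith_supportFunction hB).continuous.comp_stronglyMeasurable hmean).measurable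
    fun x i y => ?_
  rw [empiricalMean_update, add_sub_right_comm, sub_le_iff_le_add']
  refine supportFunction_add_le hB fun q => ?_
  rw [real_inner_smul_right, NNReal.coe_div, NNReal.coe_natCast, div_eq_inv_mul]
  gcongr
  exact hosc q y (x i)

variable [CompleteSpace H]

lemma integral_inner_eval_of_ne {Z : X → H} (hZ : Integrable Z ν) {i j : Fin n} (hij : i ≠ j) :
    ∫ x, inner ℝ (Z (x i)) (Z (x j)) ∂(Measure.pi fun _ => ν) =
      inner ℝ (∫ y, Z y ∂ν) (∫ y, Z y ∂ν) := by
  have hev (l : Fin n) := measurePreserving_eval (fun _ : Fin n => ν) l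
  have hmap (l : Fin n) : ∫ x, Z (x l) ∂(Measure.pi fun _ => ν) = ∫ y, Z y ∂ν :=
    integral_comp_eval (μ := fun _ => ν) hZ.aestronglyMeasurable
  have hindep : IndepFun (fun x : Fin n → X => x i) (fun x => x j) (Measure.pi fun _ => ν) :=
    (iIndepFun_pi (X := fun _ => id) fun _ => aemeasurable_id).indepFun hij
  nth_rw 1 [← hmap i, ← hmap j]
  exact hindep.integral_bilin_comp_comp (hev i).aemeasurable (hev j).aemeasurable
    ((hev i).map_eq.symm ▸ hZ) ((hev j).map_eq.symm ▸ hZ) (innerSL ℝ)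

lemma integral_norm_sum_sq_of_integral_eq_zero {Z : X → H} (hZ : MemLp Z 2 ν)
    (hZ0 : ∫ y, Z y ∂ν = 0) :
    ∫ x : Fin n → X, ‖∑ j, Z (x j)‖ ^ 2 ∂(Measure.pi fun _ => ν) = n * ∫ y, ‖Z y‖ ^ 2 ∂ν := by
  have hZi := hZ.integrable one_le_two
  have hZ' (j : Fin n) := hZ.comp_measurePreserving (measurePreserving_eval (fun _ => ν) j)
  have hint (i j : Fin n) :
      Integrable (fun x => inner ℝ (Z (x i)) (Z (x j))) (Measure.pi fun _ => ν) :=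
    memLp_one_iff_integrable.1 ((innerSL ℝ).memLp_of_bilin 1 (hZ' i) (hZ' j))
  have hoff {i j : Fin n} (hij : i ≠ j) :
      ∫ x, inner ℝ (Z (x i)) (Z (x j)) ∂(Measure.pi fun _ => ν) = 0 := by
    rw [integral_inner_eval_of_ne hZi hij, hZ0, inner_zero_left]
  have hdiag (i : Fin n) :
      ∫ x, inner ℝ (Z (x i)) (Z (x i)) ∂(Measure.pi fun _ => ν) = ∫ y, ‖Z y‖ ^ 2 ∂ν := by
    simp_rw [real_inner_self_eq_norm_sq]
    exact integral_comp_eval (μ := fun _ => ν) (f := fun y => ‖Z y‖ ^ 2)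
      (hZi.aestronglyMeasurable.norm.pow 2)
  simp_rw [← real_inner_self_eq_norm_sq (∑ _, Z _), sum_inner, inner_sum]
  rw [integral_finsetSum _ fun i _ => integrable_finsetSum _ fun j _ => hint i j]
  calc ∑ i : Fin n, ∫ x, ∑ j, inner ℝ (Z (x i)) (Z (x j)) ∂(Measure.pi fun _ => ν)
      = ∑ i : Fin n, ∫ y, ‖Z y‖ ^ 2 ∂ν := Finset.sum_congr rfl fun i _ => by
        rw [integral_finsetSum _ fun j _ => hint i j,
          Finset.sum_eq_single i (fun j _ hj => hoff hj.symm) (by simp), hdiag]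
    _ = n * ∫ y, ‖Z y‖ ^ 2 ∂ν := by simp

lemma integral_norm_sub_integral_sq_le (hY : MemLp Y 2 ν) :
    ∫ x, ‖Y x - ∫ y, Y y ∂ν‖ ^ 2 ∂ν ≤ ∫ x, ‖Y x‖ ^ 2 ∂ν := by
  have hYi := hY.integrable one_le_two
  set M := ∫ y, Y y ∂ν
  have hinner : ∫ x, inner ℝ M (Y x) ∂ν = ‖M‖ ^ 2 := by
    rw [integral_inner hYi, real_inner_self_eq_norm_sq]
  have hexp (x : X) : ‖Y x - M‖ ^ 2 = ‖Y x‖ ^ 2 - 2 * inner ℝ M (Y x) + ‖M‖ ^ 2 := by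
    rw [norm_sub_sq_real, real_inner_comm]
  simp_rw [hexp]
  have hsq := hY.integrable_norm_pow two_ne_zero
  have hcross := (hYi.const_inner (𝕜 := ℝ) M).const_mul 2
  rw [integral_add (by exact hsq.sub hcross) (integrable_const _),
    integral_sub (by exact hsq) hcross, integral_const_mul, hinner]
  simp only [integral_const, probReal_univ, smul_eq_mul, one_mul]
  linarith [sq_nonneg ‖M‖]

lemma integral_norm_empiricalMean_sub_le (hY : AEStronglyMeasurable Y ν) {K : ℝ}
    (hK : ∀ x, ‖Y x‖ ≤ K) (hn : 0 < n) :
    ∫ x : Fin n → X, ‖empiricalMean Y x - ∫ y, Y y ∂ν‖ ∂(Measure.pi fun _ => ν) ≤ K / √n := by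
  have hY2 : MemLp Y 2 ν := .of_bound hY K (.of_forall hK)
  set M := ∫ y, Y y ∂ν
  have hn' : (0 : ℝ) < n := Nat.cast_pos.2 hn
  have hK0 : 0 ≤ K := (norm_nonneg _).trans (hK (nonempty_of_isProbabilityMeasure ν).some)
  have hdiff (x : Fin n → X) :
      ‖empiricalMean Y x - M‖ ^ 2 = (n : ℝ)⁻¹ ^ 2 * ‖∑ j, (Y (x j) - M)‖ ^ 2 := by
    rw [← mul_pow, ← norm_natCast (α := ℝ) n, ← norm_inv, ← norm_smul, empiricalMean,
      Finset.sum_sub_distrib, smul_sub]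
    simp [← Nat.cast_smul_eq_nsmul ℝ, smul_smul, hn'.ne']
  have hsq : ∫ x : Fin n → X, ‖empiricalMean Y x - M‖ ^ 2 ∂(Measure.pi fun _ => ν) ≤ K ^ 2 / n :=
    calc _ = (n : ℝ)⁻¹ * ∫ x, ‖Y x - M‖ ^ 2 ∂ν := by
          simp_rw [hdiff]
          rw [integral_const_mul, integral_norm_sum_sq_of_integral_eq_zero
            (Z := fun x => Y x - M) (hY2.sub (memLp_const M))
            (by simp [M, integral_sub (hY2.integrable one_le_two) (integrable_const _)])]
          field_simp
      _ ≤ (n : ℝ)⁻¹ * ∫ _, K ^ 2 ∂ν := by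
          gcongr ?_ * ?_
          exact (integral_norm_sub_integral_sq_le hY2).trans <| integral_mono
            (hY2.integrable_norm_pow two_ne_zero) (integrable_const _) fun x => by
              have := hK x
              simp only
              gcongr
      _ = K ^ 2 / n := by simp [div_eq_inv_mul]
  refine le_of_sq_le_sq ?_ (by positivity)
  have hdev : MemLp (fun x : Fin n → X => ‖empiricalMean Y x - M‖) 2 (Measure.pi fun _ => ν) :=
    ((memLp_empiricalMean hY2).sub (memLp_const M)).norm
  have hJensen := variance_nonneg (fun x : Fin n → X => ‖empiricalMean Y x - M‖)
    (Measure.pi fun _ => ν)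
  rw [variance_eq_sub hdev, sub_nonneg] at hJensen
  rw [div_pow, Real.sq_sqrt hn'.le]
  exact hJensen.trans hsq

lemma integral_supportFunction_empiricalMean_sub_le [Nonempty I] {K : ℝ}
    (hY : AEStronglyMeasurable Y ν) (hK : ∀ x, ‖Y x‖ ≤ K) (hB : ∀ i, ‖B i‖ ≤ b) (hn : 0 < n) :
    ∫ x : Fin n → X, supportFunction B (empiricalMean Y x - ∫ y, Y y ∂ν) ∂(Measure.pi fun _ => ν)
      ≤ b * (K / √n) := by
  have hb : 0 ≤ b := (norm_nonneg _).trans (hB (Classical.arbitrary I))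
  have hmean : Integrable (fun x : Fin n → X => empiricalMean Y x - ∫ y, Y y ∂ν)
      (Measure.pi fun _ => ν) :=
    (memLp_one_iff_integrable.1 (memLp_empiricalMean (.of_bound hY K (.of_forall hK)))).sub
      (integrable_const _)
  have hsup := (hmean.norm.const_mul b).mono'
    ((lipschitzWith_supportFunction hB).continuous.comp_aestronglyMeasurable
      hmean.aestronglyMeasurable) (.of_forall fun x => abs_supportFunction_le hB _)
  calc ∫ x : Fin n → X, supportFunction B (empiricalMean Y x - ∫ y, Y y ∂ν)
          ∂(Measure.pi fun _ => ν)
      ≤ ∫ x : Fin n → X, b * ‖empiricalMean Y x - ∫ y, Y y ∂ν‖ ∂(Measure.pi fun _ => ν) :=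
        integral_mono hsup (hmean.norm.const_mul b) fun x =>
          (le_abs_self _).trans (abs_supportFunction_le hB _)
    _ ≤ b * (K / √n) := by
        rw [integral_const_mul]
        gcongr
        exact integral_norm_empiricalMean_sub_le hY hK hn

theorem exists_measurableSet_forall_inner_empiricalMean_le {K c : ℝ} (hY : StronglyMeasurable Y)
    (hK : ∀ x, ‖Y x‖ ≤ K) (hB : ∀ i, ‖B i‖ ≤ b) (hc : 0 < c)
    (hosc : ∀ i x y, inner ℝ (B i) (Y x - Y y) ≤ c) (hn : 0 < n) {δ : ℝ} (hδ0 : 0 < δ)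
    (hδ1 : δ < 1) :
    ∃ S : Set (Fin n → X), MeasurableSet S ∧
      ENNReal.ofReal (1 - δ) ≤ Measure.pi (fun _ => ν) S ∧
      ∀ x ∈ S, ∀ i, inner ℝ (B i) (empiricalMean Y x - ∫ y, Y y ∂ν) ≤
        b * (K / √n) + c * √(Real.log (1 / δ) / (2 * n)) := by
  rcases isEmpty_or_nonempty I with _ | _
  · exact ⟨Set.univ, .univ, by simpa using hδ0.le, fun _ _ i => isEmptyElim i⟩
  lift c to ℝ≥0 using hc.le
  have : (0 : ℝ) < n := Nat.cast_pos.2 hn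
  set Ψ : (Fin n → X) → ℝ := fun x => supportFunction B (empiricalMean Y x - ∫ y, Y y ∂ν)
  set ε := c * √(Real.log (1 / δ) / (2 * n))
  have hΨ : HasSubgaussianMGF (fun x => Ψ x - ∫ z, Ψ z ∂(Measure.pi fun _ => ν)) _ _ :=
    hasSubgaussianMGF_supportFunction_empiricalMean_sub hY hB hosc _
  have hlog : 0 < Real.log (1 / δ) := Real.log_pos (one_lt_one_div hδ0 hδ1)
  have hexp : Real.exp (-ε ^ 2 / (2 * (∑ _ : Fin n, (c / n / 2) ^ 2 : ℝ≥0))) = δ := by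
    have : -ε ^ 2 / (2 * (∑ _ : Fin n, (c / n / 2) ^ 2 : ℝ≥0)) = -Real.log (1 / δ) := by
      rw [mul_pow, Real.sq_sqrt (by positivity)]
      simp only [Finset.sum_const, Finset.card_univ, Fintype.card_fin, nsmul_eq_mul]
      push_cast
      field_simp
    rw [this, one_div, Real.log_inv, neg_neg, Real.exp_log hδ0]
  obtain ⟨S, hS, hSδ, hlt⟩ := exists_measurableSet_forall_lt_of_hasSubgaussianMGF hΨ (ε := ε)
    (by positivity)
  refine ⟨S, hS, hexp ▸ hSδ, fun x hx i => ?_⟩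
  calc inner ℝ (B i) (empiricalMean Y x - ∫ y, Y y ∂ν) ≤ Ψ x := inner_le_supportFunction hB i _
    _ ≤ (∫ z, Ψ z ∂(Measure.pi fun _ => ν)) + ε := by linarith [hlt x hx]
    _ ≤ b * (K / √n) + ε := by
        gcongr
        exact integral_supportFunction_empiricalMean_sub_le hY.aestronglyMeasurable hK hB hn

end EmpiricalMean

section FeatureOperator

variable {X H : Type*} [MeasurableSpace X] [NormedAddCommGroup H] [InnerProductSpace ℝ H]
  {ν : Measure X} [IsFiniteMeasure ν]

/-- The operator `g ↦ ⟪φ ·, g⟫` from `H` to `L²(ν)` attached to a square integrable feature map `φ`,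
as a continuous linear function of `φ`. -/
def featureOperator : Lp H 2 ν →L[ℝ] H →L[ℝ] Lp ℝ 2 ν :=
  (ContinuousLinearMap.compL ℝ H (Lp H ∞ ν) (Lp ℝ 2 ν)).flip (Lp.constL ∞ ν ℝ) ∘L
    (innerSL ℝ).holderL ν 2 ∞ 2

lemma featureOperator_ae_eq (φ : Lp H 2 ν) (g : H) :
    featureOperator φ g =ᵐ[ν] fun x => inner ℝ (φ x) g := by
  filter_upwards [(innerSL ℝ).coeFn_holder (r := 2) φ (Lp.const ∞ ν g),
    Lp.coeFn_const (p := ∞) (μ := ν) g] with x hx hg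
  exact hx.trans (by rw [hg]; rfl)

lemma isCompactOperator_featureOperator (φ : Lp H 2 ν) : IsCompactOperator (featureOperator φ) := by
  refine Lp.induction (by simp) (fun φ : Lp H 2 ν => IsCompactOperator (featureOperator φ))
    (fun c s hs hνs => ?_) (fun f g hf hg _ hcf hcg => ?_) ?_ φ
  · have hrank : featureOperator (indicatorConstLp 2 hs hνs.ne c) =
        (innerSL ℝ c).smulRight (indicatorConstLp 2 hs hνs.ne (1 : ℝ)) := by
      ext1 g
      refine Lp.ext ?_
      filter_upwards [featureOperator_ae_eq (indicatorConstLp 2 hs hνs.ne c) g,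
        indicatorConstLp_coeFn (hs := hs) (hμs := hνs.ne) (c := c),
        indicatorConstLp_coeFn (p := 2) (hs := hs) (hμs := hνs.ne) (c := (1 : ℝ)),
        Lp.coeFn_smul (inner ℝ c g) (indicatorConstLp 2 hs hνs.ne (1 : ℝ))] with x h h1 h2 h3
      rw [ContinuousLinearMap.smulRight_apply, innerSL_apply_apply, h, h1, h3, Pi.smul_apply, h2]
      by_cases hx : x ∈ s <;> simp [hx]
    rw [Lp.simpleFunc.coe_indicatorConst, hrank]
    exact (isCompactOperator_id (E := ℝ)).comp_clm (innerSL ℝ c) |>.clm_comp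
      (ContinuousLinearMap.toSpanSingleton ℝ (indicatorConstLp 2 hs hνs.ne (1 : ℝ)))
  · rw [map_add]
    exact hcf.add hcg
  · exact isClosed_setOfPred_isCompactOperator.preimage featureOperator.continuous

lemma inner_featureOperator (φ : Lp H 2 ν) (f : Lp ℝ 2 ν) (g : H) :
    inner ℝ f (featureOperator φ g) = ∫ x, f x * inner ℝ (φ x) g ∂ν := by
  rw [L2.inner_def]
  refine integral_congr_ae ?_
  filter_upwards [featureOperator_ae_eq φ g] with x hx
  simp [hx, mul_comm]

variable [CompleteSpace H]

open ContinuousLinearMap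

lemma isEigenfunction_iff_featureOperator_adjoint {φ : Lp H 2 ν} {k : X → X → ℝ}
    (hk : ∀ᵐ x ∂ν, ∀ᵐ y ∂ν, k x y = inner ℝ (φ x) (φ y)) {c : ℝ} {f : Lp ℝ 2 ν} :
    IsEigenfunction ν k c f ↔
      featureOperator φ (adjoint (featureOperator φ) f) = c • f := by
  have hT : integralOperator ν k f =ᵐ[ν]
      featureOperator φ (adjoint (featureOperator φ) f) := by
    filter_upwards [hk, featureOperator_ae_eq φ (adjoint (featureOperator φ) f)] with x hkx hx
    rw [hx, adjoint_inner_right, real_inner_comm, inner_featureOperator]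
    refine integral_congr_ae ?_
    filter_upwards [hkx] with y hy
    rw [hy, real_inner_comm]
  rw [Lp.ext_iff]
  exact ⟨fun h => hT.symm.trans (h.trans (Lp.coeFn_smul c f).symm),
    fun h => hT.trans (h.trans (Lp.coeFn_smul c f))⟩

lemma ae_mem_orthogonal_ker_featureOperator (φ : Lp H 2 ν) :
    ∀ᵐ x ∂ν, φ x ∈ (featureOperator φ).kerᗮ := by
  set N := (featureOperator φ).ker
  obtain ⟨t, ht, hφt⟩ := (Lp.aestronglyMeasurable φ).isSeparable_ae_range
  suffices h : (fun x => N.starProjection (φ x)) =ᵐ[ν] 0 by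
    filter_upwards [h] with x hx using N.starProjection_apply_eq_zero_iff.1 hx
  refine ae_eq_zero_of_forall_dual_of_isSeparable ℝ (ht.image N.starProjection.continuous)
    (fun L => ?_) (hφt.mono fun x hx => ⟨_, hx, rfl⟩)
  set g := (InnerProductSpace.toDual ℝ H).symm L
  have hg : featureOperator φ (N.starProjection g) = 0 := N.starProjection_apply_mem _
  filter_upwards [featureOperator_ae_eq φ (N.starProjection g), Lp.coeFn_zero ℝ 2 ν] with x hx h0
  rw [hg, h0] at hx
  rw [← InnerProductSpace.toDual_symm_apply, real_inner_comm, N.inner_starProjection_left_eq_right]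
  exact hx.symm

end FeatureOperator

section SingularSystem

open ContinuousLinearMap Submodule

lemma mem_orthogonal_span_range_iff {𝕜 E ι : Type*} [RCLike 𝕜] [NormedAddCommGroup E]
    [InnerProductSpace 𝕜 E] {v : ι → E} {f : E} :
    f ∈ (span 𝕜 (Set.range v))ᗮ ↔ ∀ i, inner 𝕜 (v i) f = 0 := by
  rw [mem_orthogonal]
  refine ⟨fun h i => h _ (subset_span ⟨i, rfl⟩), fun h u hu => ?_⟩
  have hle : span 𝕜 (Set.range v) ≤ (𝕜 ∙ f)ᗮ :=
    span_le.2 (Set.range_subset_iff.2 fun i => mem_orthogonal_singleton_iff_inner_left.2 (h i))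
  exact mem_orthogonal_singleton_iff_inner_left.1 (hle hu)

variable {E ι : Type*} [NormedAddCommGroup E] [InnerProductSpace ℝ E] [CompleteSpace E] {μ : ι → E}

lemma apply_eq_zero_of_exhaustive_eigenvectors {T : E →L[ℝ] E} (hTc : IsCompactOperator T)
    (hTs : T.IsSymmetric) {c : ι → ℝ} (hμ : ∀ i, T (μ i) = c i • μ i)
    (hex : ∀ (a : ℝ) (f : E), a ≠ 0 → T f = a • f → (∀ i, inner ℝ (μ i) f = 0) → f = 0)
    {f : E} (hf : ∀ i, inner ℝ (μ i) f = 0) : T f = 0 := by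
  have hinv : ∀ g ∈ (span ℝ (Set.range μ))ᗮ, T g ∈ (span ℝ (Set.range μ))ᗮ := fun g hg => by
    rw [mem_orthogonal_span_range_iff] at hg ⊢
    intro i
    rw [← hTs.apply_clm, hμ, inner_smul_left, hg i, mul_zero]
  have hzero : T.restrict hinv = 0 := by
    refine (eq_zero_of_forall_hasEigenvalue_eq_zero (hTc.restrict' hinv)
      (hTs.restrict_invariant hinv)).1 fun a ha => ?_
    by_contra ha0
    obtain ⟨g, hg⟩ := ha.exists_hasEigenvector
    exact hg.2 (Subtype.ext (hex a g ha0 (congrArg Subtype.val hg.apply_eq_smul)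
      (mem_orthogonal_span_range_iff.1 g.2)))
  exact congrArg Subtype.val
    (DFunLike.congr_fun hzero ⟨f, mem_orthogonal_span_range_iff.2 hf⟩)

variable {H : Type*} [NormedAddCommGroup H] [InnerProductSpace ℝ H] [CompleteSpace H]
  {D : H →L[ℝ] E}

lemma apply_eq_zero_of_exhaustive_singular_vectors (hD : IsCompactOperator D) {c : ι → ℝ}
    (hμ : ∀ i, D (adjoint D (μ i)) = c i • μ i)
    (hex : ∀ (a : ℝ) (f : E), a ≠ 0 → D (adjoint D f) = a • f →
      (∀ i, inner ℝ (μ i) f = 0) → f = 0)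
    {g : H} (hg : ∀ i, inner ℝ (adjoint D (μ i)) g = 0) : D g = 0 := by
  have hDD : D g ∈ (D ∘L adjoint D).ker := apply_eq_zero_of_exhaustive_eigenvectors
    (hD.comp_clm (adjoint D)) (isPositive_self_comp_adjoint D).isSymmetric hμ hex
    fun i => by rw [← adjoint_inner_left]; exact hg i
  rw [ker_self_comp_adjoint] at hDD
  have hg' : g ∈ (adjoint D ∘L D).ker := hDD
  rwa [ker_adjoint_comp_self] at hg'

lemma exists_hilbertBasis_of_exhaustive_singular_vectors (hD : IsCompactOperator D)
    (hμo : Orthonormal ℝ μ) {s : ι → ℝ} (hs : ∀ i, s i ≠ 0)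
    (hμ : ∀ i, D (adjoint D (μ i)) = s i ^ 2 • μ i)
    (hex : ∀ (a : ℝ) (f : E), a ≠ 0 → D (adjoint D f) = a • f →
      (∀ i, inner ℝ (μ i) f = 0) → f = 0) :
    ∃ e : HilbertBasis ι ℝ (D.ker)ᗮ, ∀ i, D (e i) = s i • μ i := by
  have hmem (i) : (s i)⁻¹ • adjoint D (μ i) ∈ (D.ker)ᗮ := by
    refine smul_mem _ _ ((mem_orthogonal _ _).2 fun g hg => ?_)
    rw [adjoint_inner_right, show D g = 0 from hg, inner_zero_left]
  have ho : Orthonormal ℝ fun i => (⟨_, hmem i⟩ : (D.ker)ᗮ) := by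
    classical
    rw [orthonormal_iff_ite] at hμo ⊢
    intro i j
    rw [coe_inner, inner_smul_left, inner_smul_right, adjoint_inner_left, hμ, inner_smul_right,
      hμo]
    split_ifs with h
    · subst h
      have := hs i
      simp only [conj_trivial]
      field_simp
    · simp
  have hbot : (span ℝ (Set.range fun i => (⟨_, hmem i⟩ : (D.ker)ᗮ)))ᗮ = ⊥ := by
    refine (Submodule.eq_bot_iff _).2 fun g hg => ?_
    have hDg : D g = 0 := apply_eq_zero_of_exhaustive_singular_vectors hD hμ hex fun i => by
      have h := mem_orthogonal_span_range_iff.1 hg i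
      rw [coe_inner, inner_smul_left] at h
      exact (mul_eq_zero.1 h).resolve_left (by simpa using hs i)
    exact Subtype.ext (inner_self_eq_zero.1 ((mem_orthogonal _ _).1 g.2 g hDg))
  refine ⟨HilbertBasis.mkOfOrthogonalEqBot ho hbot, fun i => ?_⟩
  rw [HilbertBasis.coe_mkOfOrthogonalEqBot, map_smul, hμ, smul_smul, sq,
    inv_mul_cancel_left₀ (hs i)]

end SingularSystem

section InducedRKHS

variable {X H : Type*} [MeasurableSpace X] {ν : Measure X} {s : ℕ → ℝ} {μ : ℕ → Lp ℝ 2 ν}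
  [NormedAddCommGroup H] [InnerProductSpace ℝ H] {e : HilbertBasis {i // s i ≠ 0} ℝ H}
  {F : H →L[ℝ] Lp ℝ 2 ν}

lemma hasSum_singularBasis (hFe : ∀ i, F (e i) = s i • μ i) (p : H) :
    HasSum (fun i : {i // s i ≠ 0} => (s i * e.repr p i) • μ i) (F p) := by
  refine (F.hasSum (e.hasSum_repr p)).congr_fun fun i => ?_
  rw [map_smul, hFe, smul_smul, mul_comm]

lemma mem_inducedRKHS_iff_mem_range (hFe : ∀ i, F (e i) = s i • μ i) {f : Lp ℝ 2 ν} :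
    f ∈ inducedRKHS s μ ↔ f ∈ Set.range F := by
  have hsub (u : ℕ → ℝ) : HasSum (fun i => (s i * u i) • μ i) f ↔
      HasSum (fun i : {i // s i ≠ 0} => (s i * u i) • μ i) f :=
    (Subtype.val_injective.hasSum_iff fun i hi => by
      simp [not_not.1 fun h => hi ⟨⟨i, h⟩, rfl⟩]).symm
  constructor
  · rintro ⟨u, hu, hf⟩
    have hu2 : Memℓp (fun i : {i // s i ≠ 0} => u i) 2 :=
      memℓp_gen (by simpa [Function.comp_def] using hu.subtype _)
    refine ⟨e.repr.symm ⟨_, hu2⟩, (hasSum_singularBasis hFe _).unique ?_⟩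
    simpa using (hsub u).1 hf
  · rintro ⟨p, rfl⟩
    set u : ℕ → ℝ := Function.extend Subtype.val (e.repr p) 0 with hu
    have hu_val (i : {i // s i ≠ 0}) : u i = e.repr p i := Subtype.val_injective.extend_apply _ _ i
    refine ⟨u, ?_, (hsub u).2 ?_⟩
    · refine (Subtype.val_injective.summable_iff fun i hi => ?_).1
        (((lp.memℓp (e.repr p)).summable (by simp)).congr fun i => ?_)
      · simp [hu, Function.extend_apply' _ _ _ hi]
      · simp [hu_val]
    · simpa only [hu_val] using hasSum_singularBasis hFe p

variable (hμ : Orthonormal ℝ fun i : {i // s i ≠ 0} => μ i) (hFe : ∀ i, F (e i) = s i • μ i)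
include hμ hFe

lemma inner_singularVector_apply (p : H) (i : {i // s i ≠ 0}) :
    inner ℝ (μ i) (F p) = s i * e.repr p i := by
  classical
  refine ((hasSum_singularBasis hFe p).mapL (innerSL ℝ (μ i))).unique ?_
  refine (hasSum_ite_eq i (s i * e.repr p i)).congr_fun fun j => ?_
  rw [innerSL_apply_apply, inner_smul_right, orthonormal_iff_ite.1 hμ]
  split_ifs <;> simp_all

lemma hasSum_sq_norm_apply (p : H) :
    HasSum (fun i : {i // s i ≠ 0} => s i ^ 2 * e.repr p i ^ 2) (‖F p‖ ^ 2) := by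
  rw [← real_inner_self_eq_norm_sq]
  refine ((hasSum_singularBasis hFe p).mapL (innerSL ℝ (F p))).congr_fun fun i => ?_
  rw [innerSL_apply_apply, inner_smul_right, real_inner_comm, inner_singularVector_apply hμ hFe]
  ring

lemma hkInner_apply (p q : H) : hkInner s μ (F p) (F q) = inner ℝ p q := by
  refine HasSum.tsum_eq ((Subtype.val_injective.hasSum_iff fun i hi => ?_).1
    ((e.hasSum_inner_mul_inner p q).congr_fun fun i : {i // s i ≠ 0} => ?_))
  · simp [not_not.1 fun h => hi ⟨⟨i, h⟩, rfl⟩]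
  · have := i.2
    rw [Function.comp_apply, inner_singularVector_apply hμ hFe, inner_singularVector_apply hμ hFe,
      e.repr_apply_apply, e.repr_apply_apply, real_inner_comm p]
    field_simp

lemma hkNorm_apply (p : H) : hkNorm s μ (F p) = ‖p‖ := by
  rw [hkNorm, hkInner_apply hμ hFe, real_inner_self_eq_norm_sq, Real.sqrt_sq (norm_nonneg _)]

end InducedRKHS

section KyFan

variable {H : Type*} [NormedAddCommGroup H] [InnerProductSpace ℝ H]

lemma sum_le_sum_of_orthonormal_of_hasSum {ι κ : Type*} [Fintype κ] {e : ι → H}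
    (he : Orthonormal ℝ e) {q : κ → H} (hq : Orthonormal ℝ q) {a : ι → ℝ} {J : Finset ι} {τ : ℝ}
    (hτ : 0 ≤ τ) (haJ : ∀ i ∈ J, τ ≤ a i) (ha : ∀ i ∉ J, a i ≤ τ)
    (hcard : τ * Fintype.card κ ≤ τ * J.card) {E : κ → ℝ}
    (hE : ∀ k, HasSum (fun i => a i * inner ℝ (e i) (q k) ^ 2) (E k)) :
    ∑ k, E k ≤ ∑ i ∈ J, a i := by
  set t : ι → ℝ := fun i => ∑ k, inner ℝ (e i) (q k) ^ 2 with ht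
  have ht_nonneg (i) : 0 ≤ t i := Finset.sum_nonneg fun k _ => sq_nonneg _
  have ht_le_one (i) : t i ≤ 1 := by
    simpa [he.1 i, real_inner_comm] using hq.sum_inner_products_le (e i) (s := Finset.univ)
  have htsum : HasSum t (∑ k, ∑' i, inner ℝ (e i) (q k) ^ 2) :=
    hasSum_sum fun k _ => by simpa using (he.inner_products_summable (q k)).hasSum
  have htotal : ∑ k, ∑' i, inner ℝ (e i) (q k) ^ 2 ≤ Fintype.card κ := by
    refine (Finset.sum_le_card_nsmul _ _ 1 fun k _ => ?_).trans (by simp)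
    simpa [hq.1 k] using he.tsum_inner_products_le (q k)
  have hEsum : HasSum (fun i => a i * t i) (∑ k, E k) := by
    simpa only [ht, Finset.mul_sum] using hasSum_sum fun k _ => hE k
  -- Subtracting `τ` makes every summand outside `J` nonpositive.
  have hexcess : ∑ k, E k - τ * ∑ k, ∑' i, inner ℝ (e i) (q k) ^ 2 ≤ ∑ i ∈ J, (a i - τ) := by
    classical
    refine hasSum_le (fun i => ?_) (hEsum.sub (htsum.mul_left τ))
      (hasSum_sum_of_ne_finset_zero (f := fun i => if i ∈ J then a i - τ else 0)
        (by simp +contextual))|>.trans_eq (Finset.sum_congr rfl (by simp +contextual))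
    rw [← sub_mul]
    split_ifs with hi
    · exact mul_le_of_le_one_right (sub_nonneg.2 (haJ i hi)) (ht_le_one i)
    · exact mul_nonpos_of_nonpos_of_nonneg (sub_nonpos.2 (ha i hi)) (ht_nonneg i)
  rw [Finset.sum_sub_distrib, Finset.sum_const, nsmul_eq_mul] at hexcess
  linarith [mul_le_mul_of_nonneg_left htotal hτ]

end KyFan

section EmpiricalEigenvectors

variable {H : Type*} [NormedAddCommGroup H] [InnerProductSpace ℝ H] {m : ℕ} {C : Fin m → H}
  {lam : Fin m → ℝ} {v : Fin m → EuclideanSpace ℝ (Fin m)}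

/-- The `k`-th empirical eigenvector `λ_k^{-1/2} ∑ⱼ v_k[j] Cⱼ` in feature space; it is `0` where
`λ_k = 0`. -/
def empiricalEigenvector (C : Fin m → H) (lam : Fin m → ℝ)
    (v : Fin m → EuclideanSpace ℝ (Fin m)) (k : Fin m) : H :=
  (1 / √(lam k)) • ∑ j, v k j • C j

lemma inner_sum_smul_of_isEigendecomposition (hv : IsEigendecomposition (Matrix.gram ℝ C) lam v)
    (k l : Fin m) :
    inner ℝ (∑ j, v k j • C j) (∑ j, v l j • C j) = if k = l then lam l else 0 := by
  have h := Matrix.star_dotProduct_gram_mulVec C (v k) (v l)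
  have hkl : (v l).ofLp ⬝ᵥ star (v k).ofLp = if k = l then 1 else 0 :=
    (orthonormal_iff_ite.1 hv.orthonormal k l)
  rw [← h, hv.eigen, dotProduct_smul, dotProduct_comm, hkl]
  simp

lemma eigenvalue_nonneg (hv : IsEigendecomposition (Matrix.gram ℝ C) lam v) (k : Fin m) :
    0 ≤ lam k := by
  have h := inner_sum_smul_of_isEigendecomposition hv k k
  rw [if_pos rfl] at h
  exact h ▸ real_inner_self_nonneg

lemma orthonormal_empiricalEigenvector (hv : IsEigendecomposition (Matrix.gram ℝ C) lam v) :
    Orthonormal ℝ fun k : {k // lam k ≠ 0} => empiricalEigenvector C lam v k := by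
  classical
  rw [orthonormal_iff_ite]
  intro k l
  rw [empiricalEigenvector, empiricalEigenvector, inner_smul_left, inner_smul_right,
    inner_sum_smul_of_isEigendecomposition hv]
  rcases eq_or_ne k l with rfl | hkl
  · have hsqrt : √(lam k) ≠ 0 :=
      (Real.sqrt_pos.2 ((eigenvalue_nonneg hv k).lt_of_ne' k.2)).ne'
    simp only [conj_trivial, if_true]
    field_simp
    exact (Real.sq_sqrt (eigenvalue_nonneg hv k)).symm
  · simp [hkl, Subtype.val_injective.ne hkl]

lemma orthonormal_empiricalEigenvector_castLE
    (hv : IsEigendecomposition (Matrix.gram ℝ C) lam v) {d : ℕ} (hdm : d ≤ m)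
    (hpos : ∀ i : Fin d, 0 < lam (Fin.castLE hdm i)) :
    Orthonormal ℝ fun i : Fin d => empiricalEigenvector C lam v (Fin.castLE hdm i) :=
  (orthonormal_empiricalEigenvector hv).comp (fun i => ⟨Fin.castLE hdm i, (hpos i).ne'⟩)
    fun i j hij => by simpa using hij

lemma sum_inner_sq_eq_sum_inner_sum_smul_sq (hv : Orthonormal ℝ v) (q : H) :
    ∑ j, inner ℝ (C j) q ^ 2 = ∑ k, inner ℝ (∑ j, v k j • C j) q ^ 2 := by
  set b := OrthonormalBasis.mk hv
    (hv.linearIndependent.span_eq_top_of_card_eq_finrank' (by simp)).ge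
  have hparseval := b.sum_sq_norm_inner_right (WithLp.toLp 2 fun j => inner ℝ (C j) q)
  simp only [b, OrthonormalBasis.coe_mk, EuclideanSpace.norm_sq_eq, Real.norm_eq_abs, sq_abs]
    at hparseval
  rw [← hparseval]
  refine Finset.sum_congr rfl fun k _ => ?_
  simp only [PiLp.inner_apply, sum_inner, real_inner_smul_left]
  exact congrArg (· ^ 2) (Finset.sum_congr rfl fun j _ => by simp [mul_comm])

lemma sum_inner_sq_eq_sum_eigenvalue_mul (hv : IsEigendecomposition (Matrix.gram ℝ C) lam v)
    (q : H) : ∑ j, inner ℝ (C j) q ^ 2 =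
      ∑ k : {k // lam k ≠ 0}, lam k * inner ℝ (empiricalEigenvector C lam v k) q ^ 2 := by
  have hterm (k : Fin m) : inner ℝ (∑ j, v k j • C j) q ^ 2 =
      lam k * inner ℝ (empiricalEigenvector C lam v k) q ^ 2 := by
    rw [empiricalEigenvector, real_inner_smul_left]
    rcases (eigenvalue_nonneg hv k).eq_or_lt with h | h
    · have hzero := inner_sum_smul_of_isEigendecomposition hv k k
      rw [if_pos rfl, ← h, inner_self_eq_zero] at hzero
      simp [hzero]
    · rw [mul_pow, div_pow, Real.sq_sqrt h.le]
      field_simp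
  rw [sum_inner_sq_eq_sum_inner_sum_smul_sq hv.orthonormal, Finset.sum_congr rfl fun k _ => hterm k,
    ← Finset.sum_subtype (Finset.univ.filter fun k => lam k ≠ 0) (by simp)
      (fun k => lam k * inner ℝ (empiricalEigenvector C lam v k) q ^ 2),
    Finset.sum_filter_of_ne fun k _ => left_ne_zero_of_mul]

lemma sum_inner_empiricalEigenvector_sq (hv : IsEigendecomposition (Matrix.gram ℝ C) lam v)
    (k : {k // lam k ≠ 0}) :
    ∑ j, inner ℝ (C j) (empiricalEigenvector C lam v k) ^ 2 = lam k := by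
  classical
  have ho := orthonormal_iff_ite.1 (orthonormal_empiricalEigenvector hv)
  rw [sum_inner_sq_eq_sum_eigenvalue_mul hv, Finset.sum_eq_single k]
  · rw [ho, if_pos rfl, one_pow, mul_one]
  · intro l _ hl
    simp [ho l k, hl]
  · simp

lemma sum_sum_inner_sq_le_sum_eigenvalue (hv : IsEigendecomposition (Matrix.gram ℝ C) lam v)
    {d : ℕ} (hdm : d ≤ m) (hpos : ∀ i : Fin d, 0 < lam (Fin.castLE hdm i)) {κ : Type*} [Fintype κ]
    (hκ : Fintype.card κ ≤ d) {q : κ → H} (hq : Orthonormal ℝ q) :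
    ∑ i, ∑ j, inner ℝ (C j) (q i) ^ 2 ≤ ∑ i : Fin d, lam (Fin.castLE hdm i) := by
  let top : Fin d ↪ {k // lam k ≠ 0} :=
    ⟨fun i => ⟨Fin.castLE hdm i, (hpos i).ne'⟩, fun i j hij => by simpa using hij⟩
  have hmem (k : {k // lam k ≠ 0}) : k ∈ Finset.univ.map top ↔ (k : Fin m) < d := by
    refine ⟨fun hk => ?_, fun hk => Finset.mem_map.2 ⟨⟨k, hk⟩, Finset.mem_univ _, rfl⟩⟩
    obtain ⟨i, -, rfl⟩ := Finset.mem_map.1 hk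
    exact i.2
  obtain ⟨τ, hτ, hle, hge⟩ : ∃ τ, 0 ≤ τ ∧ (∀ k ∈ Finset.univ.map top, τ ≤ lam k) ∧
      ∀ k ∉ Finset.univ.map top, lam k ≤ τ := by
    rcases hdm.eq_or_lt with rfl | hd
    · exact ⟨0, le_rfl, fun k _ => eigenvalue_nonneg hv k,
        fun k hk => absurd ((hmem k).2 k.1.2) hk⟩
    · refine ⟨lam ⟨d, hd⟩, eigenvalue_nonneg hv _, fun k hk => hv.antitone ?_,
        fun k hk => hv.antitone ?_⟩
      · exact ((hmem k).1 hk).le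
      · exact not_lt.1 fun h => hk ((hmem k).2 h)
  have h := sum_le_sum_of_orthonormal_of_hasSum (orthonormal_empiricalEigenvector hv) hq
    (a := fun k => lam k) hτ hle hge (by gcongr; simpa using hκ) fun i => hasSum_fintype _
  simp only [← sum_inner_sq_eq_sum_eigenvalue_mul hv, Finset.sum_map] at h
  exact h

end EmpiricalEigenvectors

section CapturedEnergy

open scoped TensorProduct

variable {H κ : Type*} [NormedAddCommGroup H] [InnerProductSpace ℝ H]

/-- The rank-one operator `c ⊗ c`, as a vector of the Hilbert tensor square of `H`. -/
def tensorSquare (c : H) : UniformSpace.Completion (H ⊗[ℝ] H) := ((c ⊗ₜ[ℝ] c : H ⊗[ℝ] H) :)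

lemma continuous_tensorSquare : Continuous (tensorSquare (H := H)) :=
  (UniformSpace.Completion.continuous_coe _).comp
    (TensorProduct.continuous_tmul.comp (continuous_id.prodMk continuous_id))

lemma inner_tensorSquare (c c' : H) :
    inner ℝ (tensorSquare c) (tensorSquare c') = inner ℝ c c' ^ 2 := by
  rw [tensorSquare, tensorSquare, UniformSpace.Completion.inner_coe, TensorProduct.inner_tmul, sq]

lemma norm_tensorSquare (c : H) : ‖tensorSquare c‖ = ‖c‖ ^ 2 := by
  rw [tensorSquare, UniformSpace.Completion.norm_coe, TensorProduct.norm_tmul, sq]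

variable [Fintype κ]

/-- The energy `∑ₖ ⟪c, qₖ⟫²` of `c` along `q`; for orthonormal `q`, the squared norm of the
projection of `c` onto the span of `q`. -/
def capturedEnergy (q : κ → H) (c : H) : ℝ := ∑ k, inner ℝ c (q k) ^ 2

lemma capturedEnergy_nonneg (q : κ → H) (c : H) : 0 ≤ capturedEnergy q c :=
  Finset.sum_nonneg fun _ _ => sq_nonneg _

lemma inner_sum_tensorSquare (q : κ → H) (c : H) :
    inner ℝ (∑ k, tensorSquare (q k)) (tensorSquare c) = capturedEnergy q c := by
  simp only [capturedEnergy, sum_inner, inner_tensorSquare, real_inner_comm]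

lemma capturedEnergy_le {q : κ → H} (hq : Orthonormal ℝ q) (c : H) :
    capturedEnergy q c ≤ ‖c‖ ^ 2 := by
  simpa [capturedEnergy, real_inner_comm] using hq.sum_inner_products_le c (s := Finset.univ)

lemma norm_sum_tensorSquare {q : κ → H} (hq : Orthonormal ℝ q) :
    ‖∑ k, tensorSquare (q k)‖ = √(Fintype.card κ) := by
  classical
  have ho : Orthonormal ℝ fun k => tensorSquare (q k) := by
    rw [orthonormal_iff_ite] at hq ⊢
    intro i j
    rw [inner_tensorSquare, hq]
    split_ifs <;> norm_num
  rw [← Real.sqrt_sq (norm_nonneg _), ← real_inner_self_eq_norm_sq]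
  simpa using congrArg Real.sqrt (ho.inner_sum (fun _ => (1 : ℝ)) (fun _ => 1) Finset.univ)

variable {X : Type*} {C : X → H} {K : ℝ}

lemma inner_empiricalMean_tensorSquare {m : ℕ} (q : κ → H) (x : Fin m → X) :
    inner ℝ (∑ k, tensorSquare (q k)) (empiricalMean (fun y => tensorSquare (C y)) x) =
      empiricalMean (fun y => capturedEnergy q (C y)) x := by
  simp only [empiricalMean, inner_smul_right, inner_sum, inner_sum_tensorSquare, smul_eq_mul]

variable [MeasurableSpace X] {ν : Measure X} [IsProbabilityMeasure ν]

lemma inner_integral_tensorSquare (hC : StronglyMeasurable C) (hK : ∀ x, ‖C x‖ ≤ K) (q : κ → H) :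
    inner ℝ (∑ k, tensorSquare (q k)) (∫ x, tensorSquare (C x) ∂ν) =
      ∫ x, capturedEnergy q (C x) ∂ν := by
  have hint : Integrable (fun x => tensorSquare (C x)) ν :=
    .of_bound (continuous_tensorSquare.comp_stronglyMeasurable hC).aestronglyMeasurable (K ^ 2)
      (.of_forall fun x => by rw [norm_tensorSquare]; gcongr; exact hK x)
  simp only [← integral_inner hint, inner_sum_tensorSquare]

lemma deviation_nonneg (K : ℝ) (d m : ℕ) (δ : ℝ) : 0 ≤ deviation K d m δ := by
  unfold deviation
  positivity

lemma two_mul_sqrt_mul_add_le_deviation {K δ : ℝ} (hδ0 : 0 < δ) (hδ1 : δ < 1) {d m : ℕ}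
    (hm : 0 < m) :
    2 * √d * (K ^ 2 / √m) + 2 * K ^ 2 * √(Real.log (1 / δ) / (2 * m)) ≤ deviation K d m δ := by
  have hlog : Real.log (1 / δ) ≤ Real.log (6 / δ) := by gcongr; norm_num
  have hlog0 : 0 ≤ Real.log (1 / δ) := Real.log_nonneg ((one_le_div hδ0).2 hδ1.le)
  have hsqrt : √(Real.log (1 / δ) / (2 * m)) ≤ √(Real.log (6 / δ)) / √m := by
    rw [← Real.sqrt_div' _ m.cast_nonneg]
    have hm' : (0 : ℝ) < m := Nat.cast_pos.2 hm
    gcongr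
    · exact hlog0.trans hlog
    · linarith
  calc 2 * √d * (K ^ 2 / √m) + 2 * K ^ 2 * √(Real.log (1 / δ) / (2 * m))
      ≤ 2 * √d * (K ^ 2 / √m) + 3 * K ^ 2 * (√(Real.log (6 / δ)) / √m) := by gcongr; norm_num
    _ = deviation K d m δ := by rw [deviation]; ring

theorem exists_measurableSet_forall_capturedEnergy_sub_le (hC : StronglyMeasurable C) (hK0 : 0 < K)
    (hK : ∀ x, ‖C x‖ ≤ K) {d : ℕ} {o : κ → H} (ho : Orthonormal ℝ o) (hκ : Fintype.card κ ≤ d)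
    {m : ℕ} (hm : 0 < m) {δ : ℝ} (hδ0 : 0 < δ) (hδ1 : δ < 1) :
    ∃ S : Set (Fin m → X), MeasurableSet S ∧
      ENNReal.ofReal (1 - δ) ≤ Measure.pi (fun _ => ν) S ∧
      ∀ x ∈ S, ∀ q : Fin d → H, Orthonormal ℝ q →
        empiricalMean (fun y => capturedEnergy q (C y)) x -
            empiricalMean (fun y => capturedEnergy o (C y)) x -
          (∫ y, capturedEnergy q (C y) ∂ν - ∫ y, capturedEnergy o (C y) ∂ν) ≤
        deviation K d m δ := by
  have hKsq (x) : ‖C x‖ ^ 2 ≤ K ^ 2 := by gcongr; exact hK x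
  have hnorm (q : {q : Fin d → H // Orthonormal ℝ q}) :
      ‖∑ k, tensorSquare (q.1 k) - ∑ k, tensorSquare (o k)‖ ≤ 2 * √d := by
    have hod : √(Fintype.card κ : ℝ) ≤ √d := by gcongr
    refine (norm_sub_le _ _).trans ?_
    rw [norm_sum_tensorSquare q.2, norm_sum_tensorSquare ho, Fintype.card_fin]
    linarith
  obtain ⟨S, hS, hSδ, hle⟩ := exists_measurableSet_forall_inner_empiricalMean_le (ν := ν)
    (Y := fun x => tensorSquare (C x)) (K := K ^ 2) (c := 2 * K ^ 2)
    (continuous_tensorSquare.comp_stronglyMeasurable hC)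
    (fun x => (norm_tensorSquare _).trans_le (hKsq x)) hnorm (by positivity)
    (fun q x y => by
      simp only [inner_sub_left, inner_sub_right, inner_sum_tensorSquare]
      linarith [capturedEnergy_nonneg o (C x), capturedEnergy_nonneg q.1 (C y), hKsq x, hKsq y,
        capturedEnergy_le q.2 (C x), capturedEnergy_le ho (C y)]) hm hδ0 hδ1
  refine ⟨S, hS, hSδ, fun x hx q hq => ?_⟩
  have h := (hle x hx ⟨q, hq⟩).trans (two_mul_sqrt_mul_add_le_deviation hδ0 hδ1 hm)
  simp only [inner_sub_left, inner_sub_right, inner_empiricalMean_tensorSquare,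
    inner_integral_tensorSquare hC hK] at h
  linarith

end CapturedEnergy

section PrincipalSubspace

variable {X H : Type*} [MeasurableSpace X] {ν : Measure X} {s : ℕ → ℝ} {μ : ℕ → Lp ℝ 2 ν}
  [NormedAddCommGroup H] [InnerProductSpace ℝ H] {e : HilbertBasis {i // s i ≠ 0} ℝ H}
  {F : H →L[ℝ] Lp ℝ 2 ν}

section

variable (hμ : Orthonormal ℝ fun i : {i // s i ≠ 0} => μ i) (hFe : ∀ i, F (e i) = s i • μ i)
include hμ hFe

lemma norm_sq_apply_singularVector (i : {i // s i ≠ 0}) : ‖F (e i)‖ ^ 2 = s i ^ 2 := by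
  rw [hFe, norm_smul, hμ.1 i, mul_one, Real.norm_eq_abs, sq_abs]

lemma sum_norm_sq_apply_singularVector (d : ℕ) :
    ∑ j : {j : Fin d // s j ≠ 0}, ‖F (e ⟨j, j.2⟩)‖ ^ 2 = ∑ l ∈ Finset.range d, s l ^ 2 := by
  simp only [norm_sq_apply_singularVector hμ hFe]
  rw [← Finset.sum_subtype (Finset.univ.filter fun j : Fin d => s j ≠ 0) (by simp)
      (fun j : Fin d => s j ^ 2), Finset.sum_filter_of_ne, Fin.sum_univ_eq_sum_range
      (fun l => s l ^ 2)]
  exact fun j _ hj h0 => hj (by simp [h0])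

variable (hs0 : ∀ i, 0 ≤ s i) (hs : Antitone s)
include hs0 hs

lemma norm_apply_le (p : H) : ‖F p‖ ≤ s 0 * ‖p‖ := by
  refine le_of_sq_le_sq ?_ (mul_nonneg (hs0 0) (norm_nonneg _))
  have hp : HasSum (fun i => e.repr p i ^ 2) (‖p‖ ^ 2) := by
    simpa [e.repr_apply_apply, real_inner_comm p, sq] using e.hasSum_inner_mul_inner p p
  rw [mul_pow]
  refine hasSum_le (fun i => ?_) (hasSum_sq_norm_apply hμ hFe p) (hp.mul_left _)
  have := hs0 i
  have := hs (Nat.zero_le i)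
  gcongr

theorem sum_norm_sq_apply_le {d : ℕ} {κ : Type*} [Fintype κ] (hκ : Fintype.card κ = d + 1)
    {q : κ → H} (hq : Orthonormal ℝ q) :
    ∑ k, ‖F (q k)‖ ^ 2 ≤ ∑ l ∈ Finset.range (d + 1), s l ^ 2 := by
  set J : Finset {i // s i ≠ 0} := (Finset.range (d + 1)).subtype fun i => s i ≠ 0 with hJ
  have hJ_mem (i) : i ∈ J ↔ (i : ℕ) ≤ d := by simp [hJ]
  have hsq {i j : ℕ} (hij : i ≤ j) : s j ^ 2 ≤ s i ^ 2 := pow_le_pow_left₀ (hs0 j) (hs hij) 2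
  have hcard : s d ^ 2 * Fintype.card κ ≤ s d ^ 2 * J.card := by
    rcases (hs0 d).eq_or_lt with hd | hd
    · simp [← hd]
    · rw [hκ, hJ, Finset.card_subtype, Finset.filter_true_of_mem, Finset.card_range]
      exact fun i hi => (hd.trans_le (hs (Nat.lt_succ_iff.1 (Finset.mem_range.1 hi)))).ne'
  refine (sum_le_sum_of_orthonormal_of_hasSum e.orthonormal hq (sq_nonneg (s d))
    (fun i hi => hsq ((hJ_mem i).1 hi))
    (fun i hi => hsq (not_le.1 fun h => hi ((hJ_mem i).2 h)).le) hcard fun k => by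
      simpa only [e.repr_apply_apply] using hasSum_sq_norm_apply hμ hFe (q k)).trans ?_
  rw [hJ, Finset.sum_subtype_eq_sum_filter (f := fun i => s i ^ 2)]
  exact Finset.sum_le_sum_of_subset_of_nonneg (Finset.filter_subset _ _) fun i _ _ => sq_nonneg _

theorem norm_sq_apply_le_of_orthogonal {d : ℕ} {η : ℝ} {p : Fin d → H} (hp : Orthonormal ℝ p)
    (hη : ∑ l ∈ Finset.range d, s l ^ 2 - η ≤ ∑ i, ‖F (p i)‖ ^ 2) {h : H}
    (hh : ∀ i, inner ℝ (p i) h = 0) : ‖F h‖ ^ 2 ≤ (s d ^ 2 + η) * ‖h‖ ^ 2 := by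
  rcases eq_or_ne h 0 with rfl | h0
  · simp
  have hnorm : ‖h‖ ≠ 0 := norm_ne_zero_iff.2 h0
  set u := ‖h‖⁻¹ • h with hu
  have hpu (i) : inner ℝ (p i) u = 0 := by rw [hu, inner_smul_right, hh, mul_zero]
  have hq : Orthonormal ℝ (fun o : Option (Fin d) => o.elim u p) := by
    rw [orthonormal_iff_ite] at hp ⊢
    rintro (_ | i) (_ | j)
    · simp [hu, norm_smul, hnorm]
    · simp [real_inner_comm, hpu]
    · simp [hpu]
    · simp [hp]
  have htotal := sum_norm_sq_apply_le hμ hFe hs0 hs (d := d) (by simp) hq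
  rw [Fintype.sum_option, Finset.sum_range_succ] at htotal
  simp only [Option.elim] at htotal
  have hscale : ‖F h‖ ^ 2 = ‖F u‖ ^ 2 * ‖h‖ ^ 2 := by
    rw [hu, map_smul, norm_smul, norm_inv, norm_norm]
    field_simp
  rw [hscale]
  gcongr
  linarith

end

variable {C : X → H} {K : ℝ}

lemma integral_capturedEnergy (hFC : ∀ p, F p =ᵐ[ν] fun x => inner ℝ (C x) p) {κ : Type*}
    [Fintype κ] (q : κ → H) : ∫ y, capturedEnergy q (C y) ∂ν = ∑ k, ‖F (q k)‖ ^ 2 := by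
  have henergy (k : κ) : (fun x => (F (q k) x) ^ 2) =ᵐ[ν] fun x => inner ℝ (C x) (q k) ^ 2 :=
    (hFC (q k)).fun_comp (· ^ 2)
  simp only [capturedEnergy]
  rw [integral_finsetSum _ fun k _ => (Lp.memLp (F (q k))).integrable_sq.congr (henergy k)]
  refine Finset.sum_congr rfl fun k _ => ?_
  rw [← real_inner_self_eq_norm_sq, L2.inner_def, ← integral_congr_ae (henergy k)]
  simp [sq]

theorem exists_measurableSet_sum_sq_sub_deviation_le [IsProbabilityMeasure ν]
    (hμ : Orthonormal ℝ fun i : {i // s i ≠ 0} => μ i) (hFe : ∀ i, F (e i) = s i • μ i)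
    (hC : StronglyMeasurable C) (hK0 : 0 < K) (hK : ∀ x, ‖C x‖ ≤ K)
    (hFC : ∀ p, F p =ᵐ[ν] fun x => inner ℝ (C x) p) {m d : ℕ} (hm : 0 < m) (hdm : d ≤ m) {δ : ℝ}
    (hδ0 : 0 < δ) (hδ1 : δ < 1) :
    ∃ S : Set (Fin m → X), MeasurableSet S ∧
      ENNReal.ofReal (1 - δ) ≤ Measure.pi (fun _ => ν) S ∧
      ∀ x ∈ S, ∀ (lam : Fin m → ℝ) (v : Fin m → EuclideanSpace ℝ (Fin m)),
        IsEigendecomposition (Matrix.gram ℝ fun j => C (x j)) lam v →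
        (∀ i : Fin d, 0 < lam (Fin.castLE hdm i)) →
        ∑ l ∈ Finset.range d, s l ^ 2 - deviation K d m δ ≤ ∑ i : Fin d,
          ‖F (empiricalEigenvector (fun j => C (x j)) lam v (Fin.castLE hdm i))‖ ^ 2 := by
  set o : {j : Fin d // s j ≠ 0} → H := fun j => e ⟨j, j.2⟩
  have ho : Orthonormal ℝ o :=
    e.orthonormal.comp (fun j : {j : Fin d // s j ≠ 0} => ⟨j, j.2⟩) fun i j hij =>
      Subtype.ext (Fin.ext (congrArg Subtype.val hij))
  have hcard : Fintype.card {j : Fin d // s j ≠ 0} ≤ d :=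
    (Fintype.card_subtype_le _).trans_eq (Fintype.card_fin d)
  obtain ⟨S, hS, hSδ, hle⟩ :=
    exists_measurableSet_forall_capturedEnergy_sub_le (ν := ν) hC hK0 hK ho hcard hm hδ0 hδ1
  refine ⟨S, hS, hSδ, fun x hx lam v hv hpos => ?_⟩
  set p : Fin d → H := fun i => empiricalEigenvector (fun j => C (x j)) lam v (Fin.castLE hdm i)
  have hp : Orthonormal ℝ p := orthonormal_empiricalEigenvector_castLE hv hdm hpos
  have hempirical : empiricalMean (fun y => capturedEnergy o (C y)) x ≤
      empiricalMean (fun y => capturedEnergy p (C y)) x := by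
    simp only [empiricalMean, capturedEnergy]
    rw [Finset.sum_comm, Finset.sum_comm (f := fun j i => inner ℝ (C (x j)) (p i) ^ 2)]
    gcongr
    refine (sum_sum_inner_sq_le_sum_eigenvalue hv hdm hpos hcard ho).trans_eq ?_
    exact Finset.sum_congr rfl fun i _ =>
      (sum_inner_empiricalEigenvector_sq hv ⟨_, (hpos i).ne'⟩).symm
  have hexcess := hle x hx p hp
  rw [integral_capturedEnergy hFC, integral_capturedEnergy hFC,
    sum_norm_sq_apply_singularVector hμ hFe] at hexcess
  linarith

end PrincipalSubspace

section HkProjection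

variable {X H : Type*} [MeasurableSpace X] {ν : Measure X} {d : ℕ} {Φ : Fin d → X → ℝ}

lemma encoderSpan_eq_span {Ψ : Fin d → Lp ℝ 2 ν} (hΦ : ∀ i, Ψ i =ᵐ[ν] Φ i) :
    encoderSpan Φ = (Submodule.span ℝ (Set.range Ψ) : Set (Lp ℝ 2 ν)) := by
  have hsum (w : Fin d → ℝ) :
      ((∑ i, w i • Ψ i : Lp ℝ 2 ν) : X → ℝ) =ᵐ[ν] fun y => ∑ i, w i * Φ i y := by
    refine (Lp.coeFn_finsetSum Finset.univ fun i => w i • Ψ i).trans ?_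
    filter_upwards [ae_all_iff.2 fun i => Lp.coeFn_smul (w i) (Ψ i), ae_all_iff.2 hΦ]
      with y hsmul hΨ
    simp only [Finset.sum_apply, hsmul, Pi.smul_apply, hΨ, smul_eq_mul]
  ext g
  rw [SetLike.mem_coe, Submodule.mem_span_range_iff_exists_fun]
  exact exists_congr fun w =>
    ⟨fun h => Lp.ext ((hsum w).trans h.symm), fun h => h ▸ hsum w⟩

variable {s : ℕ → ℝ} {μ : ℕ → Lp ℝ 2 ν} [NormedAddCommGroup H] [InnerProductSpace ℝ H]
  {e : HilbertBasis {i // s i ≠ 0} ℝ H} {F : H →L[ℝ] Lp ℝ 2 ν}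

instance finiteDimensional_span_range {ι : Type*} [Finite ι] (p : ι → H) :
    FiniteDimensional ℝ (Submodule.span ℝ (Set.range p)) :=
  FiniteDimensional.span_of_finite ℝ (Set.finite_range p)

lemma isHkProjection_apply_iff (hμ : Orthonormal ℝ fun i : {i // s i ≠ 0} => μ i)
    (hFe : ∀ i, F (e i) = s i • μ i) {p : Fin d → H} (hΦ : ∀ i, F (p i) =ᵐ[ν] Φ i) (u : H)
    (g : Lp ℝ 2 ν) :
    IsHkProjection s μ Φ (F u) g ↔ g = F ((Submodule.span ℝ (Set.range p)).starProjection u) := by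
  set W := Submodule.span ℝ (Set.range p) with hW
  have hspan : encoderSpan Φ = F '' W := by
    rw [encoderSpan_eq_span hΦ, hW, Set.range_comp' F p, ← ContinuousLinearMap.coe_coe F,
      Submodule.span_image, Submodule.map_coe]
  rw [IsHkProjection, hspan]
  constructor
  · rintro ⟨⟨q, hq, rfl⟩, horth⟩
    rw [Submodule.eq_starProjection_of_mem_of_inner_eq_zero hq fun w hw => ?_]
    rw [← hkInner_apply hμ hFe, map_sub]
    exact horth _ ⟨w, hw, rfl⟩
  · rintro rfl
    refine ⟨⟨_, W.starProjection_apply_mem u, rfl⟩, ?_⟩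
    rintro _ ⟨w, hw, rfl⟩
    rw [← map_sub, hkInner_apply hμ hFe]
    exact Submodule.inner_left_of_mem_orthogonal hw (W.sub_starProjection_mem_orthogonal u)

lemma centered_eq_self [IsProbabilityMeasure ν] {f : Lp ℝ 2 ν} (hf : ∫ x, f x ∂ν = 0) :
    centered f = f := by
  simp [centered, hf]

end HkProjection

section Geometry

variable {H E : Type*} [NormedAddCommGroup H] [InnerProductSpace ℝ H] [NormedAddCommGroup E]
  [NormedSpace ℝ E]

theorem norm_sq_sub_starProjection_le {F : H →L[ℝ] E} {W : Submodule ℝ H}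
    [W.HasOrthogonalProjection] {σ τ θ : ℝ} (hσ : 0 ≤ σ) (hF : ∀ h, ‖F h‖ ≤ σ * ‖h‖) (hτ : 0 ≤ τ)
    (hFW : ∀ h ∈ Wᗮ, ‖F h‖ ^ 2 ≤ τ * ‖h‖ ^ 2) {u : H} (hu : θ * ‖u‖ ^ 2 ≤ ‖F u‖ ^ 2) :
    (σ ^ 2 - τ) * ‖u - W.starProjection u‖ ^ 2 ≤ (σ ^ 2 - θ + σ * √τ) * ‖u‖ ^ 2 := by
  set a := ‖W.starProjection u‖
  set b := ‖u - W.starProjection u‖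
  have hpythagoras : ‖u‖ ^ 2 = a ^ 2 + b ^ 2 := by
    have h := W.norm_sq_eq_add_norm_sq_starProjection u
    rwa [Submodule.starProjection_orthogonal_val] at h
  have hFb : ‖F (u - W.starProjection u)‖ ≤ √τ * b := by
    refine le_of_sq_le_sq ?_ (by positivity)
    rw [mul_pow, Real.sq_sqrt hτ]
    exact hFW _ (W.sub_starProjection_mem_orthogonal u)
  have hFu : ‖F u‖ ≤ σ * a + √τ * b := by
    calc ‖F u‖ = ‖F (W.starProjection u) + F (u - W.starProjection u)‖ := by
          rw [← map_add, add_sub_cancel]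
      _ ≤ σ * a + √τ * b := (norm_add_le _ _).trans (add_le_add (hF _) hFb)
  have hcross : 2 * a * b ≤ ‖u‖ ^ 2 := hpythagoras ▸ two_mul_le_add_sq a b
  have hθ : θ * ‖u‖ ^ 2 ≤ σ ^ 2 * (‖u‖ ^ 2 - b ^ 2) + σ * √τ * ‖u‖ ^ 2 + τ * b ^ 2 := by
    calc θ * ‖u‖ ^ 2 ≤ (σ * a + √τ * b) ^ 2 := hu.trans (by gcongr)
      _ = σ ^ 2 * a ^ 2 + σ * √τ * (2 * a * b) + √τ ^ 2 * b ^ 2 := by ring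
      _ ≤ σ ^ 2 * a ^ 2 + σ * √τ * ‖u‖ ^ 2 + √τ ^ 2 * b ^ 2 := by gcongr
      _ = _ := by rw [Real.sq_sqrt hτ, hpythagoras]; ring
  linarith

theorem norm_sq_sub_starProjection_le_div {F : H →L[ℝ] E} {W : Submodule ℝ H}
    [W.HasOrthogonalProjection] {σ τ c : ℝ} (hF : ∀ h, ‖F h‖ ≤ σ * ‖h‖) (hτ : 0 ≤ τ)
    (hFW : ∀ h ∈ Wᗮ, ‖F h‖ ^ 2 ≤ τ * ‖h‖ ^ 2) (hτσ : 0 < σ ^ 2 - τ) (hc : 0 < c) (hcσ : c ≤ σ)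
    {u : H} (hu : c * ‖u‖ ≤ ‖F u‖) :
    ‖u - W.starProjection u‖ ^ 2 ≤
      (σ ^ 2 - c ^ 2 + σ * √τ) / (σ ^ 2 - τ) * (‖F u‖ ^ 2 / c ^ 2) := by
  have hσ : 0 ≤ σ := hc.le.trans hcσ
  have hu' : c ^ 2 * ‖u‖ ^ 2 ≤ ‖F u‖ ^ 2 := by rw [← mul_pow]; gcongr
  have hnum : 0 ≤ σ ^ 2 - c ^ 2 + σ * √τ :=
    add_nonneg (sub_nonneg.2 (by gcongr)) (by positivity)
  calc ‖u - W.starProjection u‖ ^ 2 ≤ (σ ^ 2 - c ^ 2 + σ * √τ) / (σ ^ 2 - τ) * ‖u‖ ^ 2 := by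
        rw [div_mul_eq_mul_div, le_div_iff₀' hτσ]
        exact norm_sq_sub_starProjection_le hσ hF hτ hFW hu'
    _ ≤ _ := by
        gcongr
        rwa [le_div_iff₀' (by positivity)]

end Geometry

section CompatibleClass

variable {X H : Type*} [MeasurableSpace X] {ν : Measure X} [IsProbabilityMeasure ν] {s : ℕ → ℝ}
  {μ : ℕ → Lp ℝ 2 ν} [NormedAddCommGroup H] [InnerProductSpace ℝ H]
  {e : HilbertBasis {i // s i ≠ 0} ℝ H} {F : H →L[ℝ] Lp ℝ 2 ν} {d : ℕ}

theorem exists_forall_isHkProjection_iff_and_norm_sq_le (hs0 : ∀ i, 0 ≤ s i) (hs : Antitone s)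
    (hμ : Orthonormal ℝ fun i : {i // s i ≠ 0} => μ i) (hFe : ∀ i, F (e i) = s i • μ i)
    (hF0 : ∀ h, ∫ x, F h x ∂ν = 0) {η : ℝ} (hη : 0 ≤ η) (hden : 0 < s 0 ^ 2 - s d ^ 2 - η)
    {p : Fin d → H} (hp : Orthonormal ℝ p)
    (hexcess : ∑ l ∈ Finset.range d, s l ^ 2 - η ≤ ∑ i, ‖F (p i)‖ ^ 2)
    {Φ : Fin d → X → ℝ} (hΦ : ∀ i, F (p i) =ᵐ[ν] Φ i) {ε : ℝ} (hε1 : ε < 1)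
    (hεs : (1 - ε) ^ 2 < s 0 ^ 2) {f : Lp ℝ 2 ν} (hf : f ∈ compatibleClass s μ ε) :
    ∃ fΦ : Lp ℝ 2 ν, (∀ g, IsHkProjection s μ Φ f g ↔ g = fΦ) ∧
      hkNorm s μ (f - fΦ) ^ 2 ≤ (s 0 ^ 2 - (1 - ε) ^ 2 + s 0 * √(s d ^ 2 + η)) /
        (s 0 ^ 2 - s d ^ 2 - η) * (‖f‖ ^ 2 / (1 - ε) ^ 2) ∧
      ‖f - fΦ‖ ^ 2 ≤ (s 0 ^ 2 - (1 - ε) ^ 2 + s 0 * √(s d ^ 2 + η)) /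
        (s 0 ^ 2 - s d ^ 2 - η) * (s 0 ^ 2 * ‖f‖ ^ 2 / (1 - ε) ^ 2) := by
  obtain ⟨hf_mem, -, hfε⟩ := hf
  obtain ⟨u, rfl⟩ := (mem_inducedRKHS_iff_mem_range hFe).1 hf_mem
  rw [centered_eq_self (hF0 u), hkNorm_apply hμ hFe] at hfε
  set W := Submodule.span ℝ (Set.range p)
  have hFW (h) (hh : h ∈ Wᗮ) : ‖F h‖ ^ 2 ≤ (s d ^ 2 + η) * ‖h‖ ^ 2 :=
    norm_sq_apply_le_of_orthogonal hμ hFe hs0 hs hp hexcess fun i =>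
      Submodule.inner_right_of_mem_orthogonal (Submodule.subset_span (Set.mem_range_self i)) hh
  have hbound := norm_sq_sub_starProjection_le_div (norm_apply_le hμ hFe hs0 hs) (by positivity)
    hFW (by linarith) (sub_pos.2 hε1) (pow_lt_pow_iff_left₀ (by linarith) (hs0 0) two_ne_zero |>.1
      hεs).le hfε
  rw [← sub_sub] at hbound
  refine ⟨F (W.starProjection u), isHkProjection_apply_iff hμ hFe hΦ u, ?_, ?_⟩
  · rwa [← map_sub, hkNorm_apply hμ hFe]
  · calc ‖F u - F (W.starProjection u)‖ ^ 2 ≤ s 0 ^ 2 * ‖u - W.starProjection u‖ ^ 2 := by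
          rw [← map_sub, ← mul_pow]
          gcongr
          exact norm_apply_le hμ hFe hs0 hs _
      _ ≤ s 0 ^ 2 * ((s 0 ^ 2 - (1 - ε) ^ 2 + s 0 * √(s d ^ 2 + η)) /
          (s 0 ^ 2 - s d ^ 2 - η) * (‖F u‖ ^ 2 / (1 - ε) ^ 2)) := by gcongr
      _ = _ := by ring

end CompatibleClass

section SectionMap

variable {X A E : Type*} [MeasurableSpace X] [MeasurableSpace A] [NormedAddCommGroup E]
  {π : Measure A} [IsFiniteMeasure π] {p : ℝ≥0∞}

lemma sum_indicatorConstLp {ι : Type*} {t : ι → Set A} (ht : ∀ i, MeasurableSet (t i))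
    (hdisj : Pairwise (Function.onFun Disjoint t)) (c : E) (F : Finset ι) :
    ∑ i ∈ F, indicatorConstLp p (ht i) (measure_ne_top π _) c =
      indicatorConstLp p (F.measurableSet_biUnion fun i _ => ht i) (measure_ne_top π _) c := by
  classical
  induction F using Finset.induction_on with
  | empty => simp only [Finset.sum_empty, Finset.notMem_empty, Set.iUnion_of_empty,
      Set.iUnion_empty, indicatorConstLp_empty]
  | insert i F hi ih =>
    have hdisj' : Disjoint (t i) (⋃ j ∈ F, t j) :=
      Set.disjoint_iUnion₂_right.2 fun j hj => hdisj fun h => hi (h ▸ hj)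
    simp only [Finset.sum_insert hi, ih, Finset.set_biUnion_insert]
    exact (indicatorConstLp_disjoint_union _ _ _ _ hdisj' c).symm

variable [Fact (1 ≤ p)]

lemma hasSum_indicatorConstLp {ι : Type*} [Countable ι] (hp : p ≠ ∞) {t : ι → Set A}
    (ht : ∀ i, MeasurableSet (t i)) (hdisj : Pairwise (Function.onFun Disjoint t)) (c : E) :
    HasSum (fun i => indicatorConstLp p (ht i) (measure_ne_top π _) c)
      (indicatorConstLp p (.iUnion ht) (measure_ne_top π _) c) := by
  simp only [HasSum, sum_indicatorConstLp ht hdisj, SummationFilter.unconditional_filter]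
  refine tendsto_indicatorConstLp_set hp ?_
  have hmono : Monotone fun F : Finset ι => ⋃ i ∈ F, t i := fun F G h =>
    Set.biUnion_subset_biUnion_left h
  have hsub (F : Finset ι) : ⋃ i ∈ F, t i ⊆ ⋃ i, t i := Set.iUnion₂_subset_iUnion _ _
  have hlim := tendsto_measure_iUnion_atTop (μ := π) hmono
  rw [← Set.iUnion_eq_iUnion_finset] at hlim
  have hdiff := ENNReal.Tendsto.sub tendsto_const_nhds hlim (.inl (measure_ne_top π (⋃ i, t i)))
  rw [tsub_self] at hdiff
  refine hdiff.congr fun F => ?_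
  rw [symmDiff_of_le (hsub F), measure_sdiff (hsub F)
    (F.measurableSet_biUnion fun i _ => ht i).nullMeasurableSet (measure_ne_top π _)]
  rfl

theorem stronglyMeasurable_indicatorConstLp_section (hp : p ≠ ∞) (c : E) {s : Set (X × A)}
    (hs : MeasurableSet s) :
    StronglyMeasurable fun x =>
      indicatorConstLp p (measurable_prodMk_left (x := x) hs) (measure_ne_top π _) c := by
  refine MeasurableSpace.induction_on_inter (C := fun s hs => StronglyMeasurable fun x =>
    indicatorConstLp p (measurable_prodMk_left (x := x) hs) (measure_ne_top π _) c)
    generateFrom_prod.symm isPiSystem_prod ?_ ?_ ?_ ?_ s hs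
  · simp only [Set.preimage_empty, indicatorConstLp_empty]
    exact stronglyMeasurable_const
  · rintro _ ⟨t, ht, u, hu, rfl⟩
    have h := (stronglyMeasurable_const
      (b := indicatorConstLp p hu (measure_ne_top π u) c)).indicator ht
    convert h using 1
    ext1 x
    by_cases hx : x ∈ t
    · simp only [Set.indicator_of_mem hx, Set.mk_preimage_prod_right hx]
    · simp only [Set.indicator_of_notMem hx, Set.mk_preimage_prod_right_eq_empty hx,
        indicatorConstLp_empty]
  · intro t ht hmeas
    have h := (stronglyMeasurable_const (b := Lp.const p π c)).sub hmeas
    convert h using 1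
    ext1 x
    have hx := indicatorConstLp_disjoint_union (p := p) (μ := π) (measurable_prodMk_left ht)
      (measurable_prodMk_left ht).compl (measure_ne_top π (Prod.mk x ⁻¹' t))
      (measure_ne_top π _) disjoint_compl_right c
    simp only [Set.union_compl_self, indicatorConstLp_univ] at hx
    simp only [Pi.sub_apply, hx, add_sub_cancel_left, Set.preimage_compl]
  · intro t hdisj ht hmeas
    have hdisj' (x : X) : Pairwise (Function.onFun Disjoint fun i => Prod.mk x ⁻¹' t i) :=
      fun i j hij => (hdisj hij).preimage _
    refine stronglyMeasurable_of_tendsto Filter.atTop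
      (fun n => Finset.stronglyMeasurable_sum (Finset.range n) fun i _ => hmeas i)
      (tendsto_pi_nhds.2 fun x => ?_)
    have h := (hasSum_indicatorConstLp (π := π) hp (fun i => measurable_prodMk_left (ht i))
      (hdisj' x) c).tendsto_sum_nat
    simpa only [Finset.sum_apply, Set.preimage_iUnion] using h

lemma stronglyMeasurable_toLp_section_simpleFunc (hp : p ≠ ∞) (f : SimpleFunc (X × A) E) :
    StronglyMeasurable fun x =>
      ((f.comp (Prod.mk x) measurable_prodMk_left).memLp_of_isFiniteMeasure p π).toLp := by
  induction f using SimpleFunc.induction with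
  | const c hs =>
    convert stronglyMeasurable_indicatorConstLp_section (π := π) hp c hs using 1
    ext1 x
    refine MemLp.toLp_congr _ _ (.of_forall fun _ => rfl)
  | add _ hf hg => exact hf.add hg

theorem stronglyMeasurable_toLp_section [SecondCountableTopology E] [MeasurableSpace E]
    [BorelSpace E] (hp : p ≠ ∞) {w : X × A → E} (hw : Measurable w)
    (h : ∀ x, MemLp (fun a => w (x, a)) p π) : StronglyMeasurable fun x => (h x).toLp := by
  refine stronglyMeasurable_of_tendsto Filter.atTop (fun n =>
    stronglyMeasurable_toLp_section_simpleFunc hp (SimpleFunc.approxOn w hw Set.univ 0 trivial n))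
    (tendsto_pi_nhds.2 fun x => ?_)
  rw [Lp.tendsto_Lp_iff_tendsto_eLpNorm'']
  exact SimpleFunc.tendsto_approxOn_Lp_eLpNorm (hw.comp measurable_prodMk_left) (Set.mem_univ 0) hp
    (by simp) (by simpa using (h x).2)

end SectionMap

section CenteredKernel

variable {X H : Type*} [MeasurableSpace X] [NormedAddCommGroup H] [InnerProductSpace ℝ H]
  [CompleteSpace H] {ν : Measure X}

theorem centeredKernel_eq_inner_sub_integral {φ : X → H} (hφ : Integrable φ ν) {R : Set X}
    (hR : ∀ᵐ x ∂ν, x ∈ R) {k : X → X → ℝ} (hk : ∀ x ∈ R, ∀ y ∈ R, k x y = inner ℝ (φ x) (φ y))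
    {x y : X} (hx : x ∈ R) (hy : y ∈ R) :
    centeredKernel ν k x y = inner ℝ (φ x - ∫ z, φ z ∂ν) (φ y - ∫ z, φ z ∂ν) := by
  have hright (x) (hx : x ∈ R) : ∫ z, k x z ∂ν = inner ℝ (φ x) (∫ z, φ z ∂ν) := by
    rw [← integral_inner hφ]
    exact integral_congr_ae (hR.mono fun z hz => hk x hx z hz)
  have hleft (y) (hy : y ∈ R) : ∫ z, k z y ∂ν = inner ℝ (φ y) (∫ z, φ z ∂ν) := by
    rw [← integral_inner hφ]
    exact integral_congr_ae (hR.mono fun z hz => (hk z hz y hy).trans (real_inner_comm _ _))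
  have htotal : ∫ z, ∫ z', k z z' ∂ν ∂ν = inner ℝ (∫ z, φ z ∂ν) (∫ z, φ z ∂ν) := by
    rw [← integral_inner hφ]
    exact integral_congr_ae (hR.mono fun z hz => (hright z hz).trans (real_inner_comm _ _))
  rw [centeredKernel, hleft y hy, hright x hx, htotal, hk x hx y hy, inner_sub_left,
    inner_sub_right, inner_sub_right, real_inner_comm (φ y) (∫ z, φ z ∂ν)]
  ring

end CenteredKernel

section DualKernel

variable {X A : Type*} [MeasurableSpace X] [MeasurableSpace A] {P : Measure (X × A)}

lemma measurable_jointDensity : Measurable fun z : X × A => jointDensity P z.1 z.2 :=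
  Measure.measurable_rnDeriv _ _

lemma measurable_jointDensity_right {x : X} : Measurable (jointDensity P x) :=
  measurable_jointDensity.comp measurable_prodMk_left

variable (P) in
/-- The points `x` at which `P⁺(·|x) / P_A` is a probability density with second moment at most
`κ²`. The bound goes through `toNNReal` so that it forces the second moment to be finite. -/
def regularPoints : Set X :=
  {x | ∫⁻ a, jointDensity P x a ∂P.snd = 1 ∧
    ∫⁻ a, jointDensity P x a ^ 2 ∂P.snd ≤ (contextComplexity P).toNNReal ^ 2}

lemma eLpNorm_toReal_jointDensity_le {x : X} (hx : x ∈ regularPoints P) :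
    eLpNorm (fun a => (jointDensity P x a).toReal) 2 P.snd ≤ (contextComplexity P).toNNReal := by
  rw [← ENNReal.pow_le_pow_left_iff two_ne_zero]
  refine le_trans ?_ hx.2
  have hsq := eLpNorm_nnreal_pow_eq_lintegral (μ := P.snd) (p := 2)
    (f := fun a => (jointDensity P x a).toReal) two_ne_zero
  norm_num at hsq
  rw [hsq]
  gcongr with a
  rw [Real.enorm_of_nonneg ENNReal.toReal_nonneg]
  exact ENNReal.ofReal_toReal_le

variable [IsProbabilityMeasure P]

lemma measurableSet_regularPoints : MeasurableSet (regularPoints P) :=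
  (measurableSet_eq_fun measurable_jointDensity.lintegral_prod_right' measurable_const).inter
    (measurableSet_le (measurable_jointDensity.pow_const 2).lintegral_prod_right' measurable_const)

lemma ae_lintegral_jointDensity_eq_one (hac : P ≪ P.fst.prod P.snd) :
    ∀ᵐ x ∂P.fst, ∫⁻ a, jointDensity P x a ∂P.snd = 1 := by
  refine ae_eq_of_forall_setLIntegral_eq_of_sigmaFinite
    measurable_jointDensity.lintegral_prod_right' measurable_const fun s hs _ => ?_
  calc ∫⁻ x in s, ∫⁻ a, jointDensity P x a ∂P.snd ∂P.fst
      = ∫⁻ z in s ×ˢ Set.univ, P.rnDeriv (P.fst.prod P.snd) z ∂P.fst.prod P.snd := by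
        rw [← Measure.prod_restrict, Measure.restrict_univ,
          lintegral_prod _ (Measure.measurable_rnDeriv _ _).aemeasurable]
        rfl
    _ = P (s ×ˢ Set.univ) := Measure.setLIntegral_rnDeriv hac _
    _ = ∫⁻ _ in s, 1 ∂P.fst := by
        rw [setLIntegral_one, Measure.fst_apply hs, Set.prod_univ]

lemma ae_mem_regularPoints (hac : P ≪ P.fst.prod P.snd) (hκ : contextComplexity P ≠ ⊤) :
    ∀ᵐ x ∂P.fst, x ∈ regularPoints P := by
  have hessSup : essSup (fun x => ∫⁻ a, jointDensity P x a ^ 2 ∂P.snd) P.fst =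
      (contextComplexity P).toNNReal ^ 2 := by
    rw [ENNReal.coe_toNNReal hκ, contextComplexity, ← ENNReal.rpow_natCast, ← ENNReal.rpow_mul]
    norm_num
  filter_upwards [ae_lintegral_jointDensity_eq_one hac,
    ENNReal.ae_le_essSup (μ := P.fst) fun x => ∫⁻ a, jointDensity P x a ^ 2 ∂P.snd] with x h1 h2
  exact ⟨h1, hessSup ▸ h2⟩

variable (P) in
open Classical in
/-- The density `P⁺(a|x) / P_A(a)`, replaced by `1` at the points that are not regular, so that
every section is a square integrable probability density. -/
def regularizedDensity (z : X × A) : ℝ :=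
  if z.1 ∈ regularPoints P then (jointDensity P z.1 z.2).toReal else 1

lemma measurable_regularizedDensity : Measurable (regularizedDensity P) :=
  .ite (measurable_fst measurableSet_regularPoints) measurable_jointDensity.ennreal_toReal
    measurable_const

lemma memLp_regularizedDensity (x : X) :
    MemLp (fun a => regularizedDensity P (x, a)) 2 P.snd := by
  by_cases hx : x ∈ regularPoints P
  · simp only [regularizedDensity, hx, if_true]
    exact ⟨measurable_jointDensity_right.ennreal_toReal.aestronglyMeasurable,
      (eLpNorm_toReal_jointDensity_le hx).trans_lt ENNReal.coe_lt_top⟩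
  · simpa only [regularizedDensity, hx, if_false] using memLp_const 1

variable (P) in
/-- The feature map `x ↦ P⁺(·|x) / P_A ∈ L²(P_A)` of the dual kernel. -/
def densityFeature (x : X) : Lp ℝ 2 P.snd := (memLp_regularizedDensity x).toLp

lemma stronglyMeasurable_densityFeature : StronglyMeasurable (densityFeature P) :=
  stronglyMeasurable_toLp_section ENNReal.ofNat_ne_top measurable_regularizedDensity
    memLp_regularizedDensity

lemma densityFeature_ae_eq {x : X} (hx : x ∈ regularPoints P) :
    densityFeature P x =ᵐ[P.snd] fun a => (jointDensity P x a).toReal := by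
  filter_upwards [(memLp_regularizedDensity (P := P) x).coeFn_toLp] with a ha
  rw [densityFeature, ha, regularizedDensity, if_pos hx]

lemma densityFeature_of_notMem {x : X} (hx : x ∉ regularPoints P) :
    densityFeature P x = Lp.const 2 P.snd 1 :=
  MemLp.toLp_congr _ (memLp_const 1) (.of_forall fun _ => if_neg hx)

lemma inner_densityFeature {x : X} (hx : x ∈ regularPoints P) (g : Lp ℝ 2 P.snd) :
    inner ℝ (densityFeature P x) g = ∫ a, (jointDensity P x a).toReal * g a ∂P.snd := by
  rw [L2.inner_def]
  refine integral_congr_ae ?_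
  filter_upwards [densityFeature_ae_eq hx] with a ha
  simp [ha, mul_comm]

lemma dualKernel_eq_inner {x y : X} (hx : x ∈ regularPoints P) (hy : y ∈ regularPoints P) :
    dualKernel P x y = inner ℝ (densityFeature P x) (densityFeature P y) := by
  rw [inner_densityFeature hx]
  refine integral_congr_ae ?_
  filter_upwards [densityFeature_ae_eq hy] with a ha
  rw [ha]

lemma inner_densityFeature_const {x : X} (hx : x ∈ regularPoints P) :
    inner ℝ (densityFeature P x) (Lp.const 2 P.snd 1) = 1 := by
  have hfinite : ∀ᵐ a ∂P.snd, jointDensity P x a < ⊤ :=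
    ae_lt_top measurable_jointDensity_right (hx.1.trans_ne ENNReal.one_ne_top)
  calc inner ℝ (densityFeature P x) (Lp.const 2 P.snd 1)
      = ∫ a, (jointDensity P x a).toReal ∂P.snd := by
        rw [inner_densityFeature hx]
        refine integral_congr_ae ?_
        filter_upwards [Lp.coeFn_const (p := 2) (μ := P.snd) (1 : ℝ)] with a ha
        rw [ha, Function.const_apply, mul_one]
    _ = 1 := by
        rw [integral_toReal measurable_jointDensity_right.aemeasurable hfinite, hx.1,
          ENNReal.toReal_one]

lemma norm_densityFeature_le {x : X} (hx : x ∈ regularPoints P) :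
    ‖densityFeature P x‖ ≤ (contextComplexity P).toReal := by
  rw [Lp.norm_def, eLpNorm_congr_ae (densityFeature_ae_eq hx)]
  exact ENNReal.toReal_le_coe_of_le_coe (eLpNorm_toReal_jointDensity_le hx)

lemma norm_const_one : ‖Lp.const 2 P.snd (1 : ℝ)‖ = 1 := by
  simp [Lp.norm_const' (μ := P.snd) (p := 2)]

theorem one_le_contextComplexity (hac : P ≪ P.fst.prod P.snd) (hκ : contextComplexity P ≠ ⊤) :
    1 ≤ (contextComplexity P).toReal := by
  obtain ⟨x, hx⟩ := (ae_mem_regularPoints hac hκ).exists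
  have hCS := real_inner_le_norm (densityFeature P x) (Lp.const 2 P.snd 1)
  rw [inner_densityFeature_const hx, norm_const_one, mul_one] at hCS
  exact hCS.trans (norm_densityFeature_le hx)

lemma integrable_densityFeature (hac : P ≪ P.fst.prod P.snd) (hκ : contextComplexity P ≠ ⊤) :
    Integrable (densityFeature P) P.fst :=
  .of_bound stronglyMeasurable_densityFeature.aestronglyMeasurable _
    ((ae_mem_regularPoints hac hκ).mono fun _ hx => norm_densityFeature_le hx)

theorem integral_densityFeature (hac : P ≪ P.fst.prod P.snd) (hκ : contextComplexity P ≠ ⊤) :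
    ∫ x, densityFeature P x ∂P.fst = Lp.const 2 P.snd 1 := by
  have hreg := ae_mem_regularPoints hac hκ
  refine ext_inner_left ℝ fun g => ?_
  have hg : Integrable (fun z : X × A => g z.2) P :=
    ((Lp.memLp g).integrable one_le_two).comp_measurable measurable_snd
  calc inner ℝ g (∫ x, densityFeature P x ∂P.fst)
      = ∫ x, inner ℝ g (densityFeature P x) ∂P.fst :=
        (integral_inner (integrable_densityFeature hac hκ) g).symm
    _ = ∫ x, ∫ a, (jointDensity P x a).toReal * g a ∂P.snd ∂P.fst :=
        integral_congr_ae <| hreg.mono fun x hx =>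
          (real_inner_comm _ _).trans (inner_densityFeature hx g)
    _ = ∫ z, (P.rnDeriv (P.fst.prod P.snd) z).toReal • g z.2 ∂P.fst.prod P.snd :=
        (integral_prod _ ((integrable_rnDeriv_smul_iff hac).2 hg)).symm
    _ = ∫ z, g z.2 ∂P := integral_rnDeriv_smul hac
    _ = ∫ a, g a ∂P.snd :=
        (integral_map measurable_snd.aemeasurable
          (Lp.stronglyMeasurable g).aestronglyMeasurable).symm
    _ = inner ℝ g (Lp.const 2 P.snd 1) := by
        rw [L2.inner_def]
        refine integral_congr_ae ?_
        filter_upwards [Lp.coeFn_const (p := 2) (μ := P.snd) (1 : ℝ)] with a ha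
        simp only [ha, Function.const_apply, RCLike.inner_apply, conj_trivial, one_mul]

end DualKernel

section ReducedFeature

open ContinuousLinearMap

variable {X H : Type*} [MeasurableSpace X] [NormedAddCommGroup H] [InnerProductSpace ℝ H]
  [CompleteSpace H] {ν : Measure X} [IsFiniteMeasure ν] {φ : X → H} (hφ : MemLp φ 2 ν)

/-- The feature map `φ` projected onto the orthogonal complement of the kernel of its feature
operator. Almost everywhere the projection changes nothing, but `H` may be larger than the RKHS of
the kernel, and only on this complement are the singular vectors of the operator a basis. -/
def reducedFeature (x : X) : (featureOperator hφ.toLp).kerᗮ :=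
  (featureOperator hφ.toLp).kerᗮ.orthogonalProjectionOnto (φ x)

/-- The feature operator of `reducedFeature`. -/
def reducedOperator : (featureOperator hφ.toLp).kerᗮ →L[ℝ] Lp ℝ 2 ν :=
  featureOperator hφ.toLp ∘L (featureOperator hφ.toLp).kerᗮ.subtypeL

lemma stronglyMeasurable_reducedFeature (hmeas : StronglyMeasurable φ) :
    StronglyMeasurable (reducedFeature hφ) :=
  (ContinuousLinearMap.continuous _).comp_stronglyMeasurable hmeas

lemma norm_reducedFeature_le (x : X) : ‖reducedFeature hφ x‖ ≤ ‖φ x‖ :=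
  Submodule.norm_orthogonalProjectionOnto_apply_le _ _

lemma inner_reducedFeature (x : X) (p : (featureOperator hφ.toLp).kerᗮ) :
    inner ℝ (reducedFeature hφ x) p = inner ℝ (φ x) p :=
  Submodule.inner_orthogonalProjectionOnto_eq_of_mem_right p (φ x)

lemma reducedOperator_ae_eq (p : (featureOperator hφ.toLp).kerᗮ) :
    reducedOperator hφ p =ᵐ[ν] fun x => inner ℝ (reducedFeature hφ x) p := by
  filter_upwards [featureOperator_ae_eq hφ.toLp p, hφ.coeFn_toLp] with x hx hφx
  rw [inner_reducedFeature, ← hφx]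
  exact hx

lemma ae_forall_inner_reducedFeature_eq :
    ∀ᵐ x ∂ν, ∀ y, inner ℝ (reducedFeature hφ x) (reducedFeature hφ y) = inner ℝ (φ x) (φ y) := by
  filter_upwards [ae_mem_orthogonal_ker_featureOperator hφ.toLp, hφ.coeFn_toLp] with x hx hφx y
  rw [hφx] at hx
  rw [real_inner_comm, inner_reducedFeature, real_inner_comm, reducedFeature,
    Submodule.coe_orthogonalProjectionOnto_apply, Submodule.starProjection_eq_self_iff.2 hx]

lemma integral_reducedOperator (hφ0 : ∫ x, φ x ∂ν = 0) (p : (featureOperator hφ.toLp).kerᗮ) :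
    ∫ x, reducedOperator hφ p x ∂ν = 0 := by
  calc ∫ x, reducedOperator hφ p x ∂ν = ∫ x, inner ℝ (p : H) (φ x) ∂ν := by
        refine integral_congr_ae ?_
        filter_upwards [reducedOperator_ae_eq hφ p] with x hx
        rw [hx, inner_reducedFeature, real_inner_comm]
    _ = 0 := by rw [integral_inner (hφ.integrable one_le_two), hφ0, inner_zero_right]

theorem exists_hilbertBasis_reducedOperator_apply_eq {k : X → X → ℝ}
    (hk : ∀ᵐ x ∂ν, ∀ᵐ y ∂ν, k x y = inner ℝ (φ x) (φ y)) {s : ℕ → ℝ} {μ : ℕ → Lp ℝ 2 ν}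
    (hsμ : IsEigensystem ν k s μ) :
    ∃ e : HilbertBasis {i // s i ≠ 0} ℝ (featureOperator hφ.toLp).kerᗮ,
      ∀ i, reducedOperator hφ (e i) = s i • μ i := by
  have hk' : ∀ᵐ x ∂ν, ∀ᵐ y ∂ν, k x y = inner ℝ (hφ.toLp φ x) (hφ.toLp φ y) := by
    filter_upwards [hk, hφ.coeFn_toLp] with x hx hφx
    filter_upwards [hx, hφ.coeFn_toLp] with y hy hφy
    rw [hφx, hφy, hy]
  exact exists_hilbertBasis_of_exhaustive_singular_vectors
    (isCompactOperator_featureOperator hφ.toLp) hsμ.orthonormal (fun i => i.2)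
    (fun i => (isEigenfunction_iff_featureOperator_adjoint hk').1 (hsμ.eigen i i.2))
    fun c f hc hf hμf => hsμ.exhaustive c f hc
      ((isEigenfunction_iff_featureOperator_adjoint hk').2 hf) fun i hi => hμf ⟨i, hi⟩

end ReducedFeature

section CenteredFeature

variable {X A : Type*} [MeasurableSpace X] [MeasurableSpace A] {P : Measure (X × A)}
  [IsProbabilityMeasure P]

variable (P) in
/-- The feature map `x ↦ P⁺(·|x) / P_A - 1 ∈ L²(P_A)` of the centered dual kernel. -/
def centeredFeature (x : X) : Lp ℝ 2 P.snd := densityFeature P x - Lp.const 2 P.snd 1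

lemma stronglyMeasurable_centeredFeature : StronglyMeasurable (centeredFeature P) :=
  stronglyMeasurable_densityFeature.sub stronglyMeasurable_const

lemma norm_centeredFeature_le (x : X) : ‖centeredFeature P x‖ ≤ (contextComplexity P).toReal := by
  by_cases hx : x ∈ regularPoints P
  · refine le_trans ?_ (norm_densityFeature_le hx)
    refine le_of_sq_le_sq ?_ (norm_nonneg _)
    rw [centeredFeature, norm_sub_sq_real, inner_densityFeature_const hx, norm_const_one]
    linarith
  · simp [centeredFeature, densityFeature_of_notMem hx]

lemma memLp_centeredFeature : MemLp (centeredFeature P) 2 P.fst :=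
  .of_bound stronglyMeasurable_centeredFeature.aestronglyMeasurable _
    (.of_forall norm_centeredFeature_le)

lemma integral_centeredFeature (hac : P ≪ P.fst.prod P.snd) (hκ : contextComplexity P ≠ ⊤) :
    ∫ x, centeredFeature P x ∂P.fst = 0 := by
  simp [centeredFeature, integral_sub (integrable_densityFeature hac hκ) (integrable_const _),
    integral_densityFeature hac hκ]

theorem centeredKernel_dualKernel_eq_inner (hac : P ≪ P.fst.prod P.snd)
    (hκ : contextComplexity P ≠ ⊤) {x y : X} (hx : x ∈ regularPoints P)
    (hy : y ∈ regularPoints P) :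
    centeredKernel P.fst (dualKernel P) x y =
      inner ℝ (centeredFeature P x) (centeredFeature P y) := by
  rw [centeredKernel_eq_inner_sub_integral (integrable_densityFeature hac hκ)
    (ae_mem_regularPoints hac hκ) (fun x hx y hy => dualKernel_eq_inner hx hy) hx hy,
    integral_densityFeature hac hκ]
  rfl

lemma ae_ae_centeredKernel_dualKernel_eq_inner (hac : P ≪ P.fst.prod P.snd)
    (hκ : contextComplexity P ≠ ⊤) :
    ∀ᵐ x ∂P.fst, ∀ᵐ y ∂P.fst, centeredKernel P.fst (dualKernel P) x y =
      inner ℝ (centeredFeature P x) (centeredFeature P y) :=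
  (ae_mem_regularPoints hac hκ).mono fun _ hx =>
    (ae_mem_regularPoints hac hκ).mono fun _ hy => centeredKernel_dualKernel_eq_inner hac hκ hx hy

theorem exists_ae_mem_and_centeredKernel_eq_inner_reducedFeature (hac : P ≪ P.fst.prod P.snd)
    (hκ : contextComplexity P ≠ ⊤) :
    ∃ R : Set X, (∀ᵐ x ∂P.fst, x ∈ R) ∧ ∀ x ∈ R, ∀ y ∈ R,
      centeredKernel P.fst (dualKernel P) x y =
        inner ℝ (reducedFeature (memLp_centeredFeature (P := P)) x)
          (reducedFeature memLp_centeredFeature y) :=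
  ⟨_, (ae_mem_regularPoints hac hκ).and (ae_forall_inner_reducedFeature_eq _),
    fun _ hx y hy => (centeredKernel_dualKernel_eq_inner hac hκ hx.1 hy.1).trans (hx.2 y).symm⟩

end CenteredFeature

section Sampling

lemma exists_subset_forall_of_ae {Ω : Type*} [MeasurableSpace Ω] {ρ : Measure Ω} {S : Set Ω}
    (hS : MeasurableSet S) {p : Ω → Prop} (hp : ∀ᵐ ω ∂ρ, p ω) :
    ∃ T ⊆ S, MeasurableSet T ∧ ρ T = ρ S ∧ ∀ ω ∈ T, p ω := by
  refine ⟨S \ toMeasurable ρ {ω | ¬p ω}, Set.sdiff_subset,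
    hS.diff (measurableSet_toMeasurable _ _), ?_, fun ω hω => ?_⟩
  · exact measure_sdiff_null ((measure_toMeasurable _).trans hp)
  · exact not_not.1 fun h => hω.2 (subset_toMeasurable _ _ h)

lemma ae_forall_mem_pi {X ι : Type*} [MeasurableSpace X] [Fintype ι] {ν : Measure X}
    [IsProbabilityMeasure ν] {R : Set X} (hR : ∀ᵐ x ∂ν, x ∈ R) :
    ∀ᵐ x ∂Measure.pi fun _ : ι => ν, ∀ i, x i ∈ R :=
  ae_all_iff.2 fun i => (measurePreserving_eval (fun _ => ν) i).quasiMeasurePreserving.ae hR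

variable {X H : Type*} [NormedAddCommGroup H] [InnerProductSpace ℝ H] {m : ℕ} {k : X → X → ℝ}
  {C : X → H} {R : Set X}

lemma gramMatrix_eq_gram (hk : ∀ x ∈ R, ∀ y ∈ R, k x y = inner ℝ (C x) (C y)) {x : Fin m → X}
    (hx : ∀ i, x i ∈ R) : gramMatrix k x = Matrix.gram ℝ fun i => C (x i) :=
  Matrix.ext fun i j => hk _ (hx i) _ (hx j)

lemma apply_empiricalEigenvector_ae_eq_kpcaEncoder [MeasurableSpace X] {ν : Measure X}
    (hR : ∀ᵐ x ∂ν, x ∈ R) (hk : ∀ x ∈ R, ∀ y ∈ R, k x y = inner ℝ (C x) (C y))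
    {F : H →L[ℝ] Lp ℝ 2 ν} (hFC : ∀ p, F p =ᵐ[ν] fun x => inner ℝ (C x) p) {x : Fin m → X}
    (hx : ∀ i, x i ∈ R) {d : ℕ} (hdm : d ≤ m) (lam : Fin m → ℝ)
    (v : Fin m → EuclideanSpace ℝ (Fin m)) (i : Fin d) :
    F (empiricalEigenvector (fun j => C (x j)) lam v (Fin.castLE hdm i)) =ᵐ[ν]
      kpcaEncoder hdm k x lam v i := by
  filter_upwards [hFC (empiricalEigenvector (fun j => C (x j)) lam v (Fin.castLE hdm i)), hR]
    with y hy hyR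
  rw [hy]
  simp only [empiricalEigenvector, kpcaEncoder, inner_smul_right, inner_sum, hk y hyR _ (hx _)]

end Sampling

end Contexture

end

open Contexture

theorem mainTheorem5 {X A : Type*} [MeasurableSpace X] [MeasurableSpace A]
    (P : MeasureTheory.Measure (X × A)) [MeasureTheory.IsProbabilityMeasure P]
    (hac : P.AbsolutelyContinuous (P.fst.prod P.snd))
    (hκ : Contexture.contextComplexity P ≠ ⊤)
    (k : X → X → ℝ) (hk : k = Contexture.centeredKernel P.fst (Contexture.dualKernel P))
    (s : ℕ → ℝ) (μ : ℕ → MeasureTheory.Lp ℝ 2 P.fst)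
    (hsμ : Contexture.IsEigensystem P.fst k s μ)
    (m d : ℕ) (hm : 0 < m) (hdm : d ≤ m)
    (ε : ℝ) (hε0 : 0 < ε) (hε1 : ε < 1) (hεs : (1 - ε) ^ 2 < s 0 ^ 2)
    (δ : ℝ) (hδ0 : 0 < δ) (hδ1 : δ < 1)
    (η : ℝ) (hη : η = Contexture.deviation (Contexture.contextComplexity P).toReal d m δ)
    (hden : 0 < s 0 ^ 2 - s d ^ 2 - η) :
    ∃ S : Set (Fin m → X), MeasurableSet S ∧
      ENNReal.ofReal (1 - δ) ≤ MeasureTheory.Measure.pi (fun _ : Fin m => P.fst) S ∧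
      ∀ x ∈ S, ∀ (lam : Fin m → ℝ) (v : Fin m → EuclideanSpace ℝ (Fin m)),
        Contexture.IsEigendecomposition (Contexture.gramMatrix k x) lam v →
        (∀ i : Fin d, 0 < lam (Fin.castLE hdm i)) →
        (∀ i : Fin d, ∃ g ∈ Contexture.inducedRKHS s μ,
          g =ᵐ[P.fst] Contexture.kpcaEncoder hdm k x lam v i) ∧
        ∀ f ∈ Contexture.compatibleClass s μ ε,
          ∃ fΦ : MeasureTheory.Lp ℝ 2 P.fst,
            (∀ g, Contexture.IsHkProjection s μ (Contexture.kpcaEncoder hdm k x lam v) f g ↔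
              g = fΦ) ∧
            Contexture.hkNorm s μ (f - fΦ) ^ 2 ≤
              (s 0 ^ 2 - (1 - ε) ^ 2 + s 0 * Real.sqrt (s d ^ 2 + η)) /
                (s 0 ^ 2 - s d ^ 2 - η) * (‖f‖ ^ 2 / (1 - ε) ^ 2) ∧
            ‖f - fΦ‖ ^ 2 ≤
              (s 0 ^ 2 - (1 - ε) ^ 2 + s 0 * Real.sqrt (s d ^ 2 + η)) /
                (s 0 ^ 2 - s d ^ 2 - η) * (s 0 ^ 2 * ‖f‖ ^ 2 / (1 - ε) ^ 2) := by
  subst hk hη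
  have hφ : MemLp (centeredFeature P) 2 P.fst := memLp_centeredFeature
  obtain ⟨e, hFe⟩ := exists_hilbertBasis_reducedOperator_apply_eq hφ
    (ae_ae_centeredKernel_dualKernel_eq_inner hac hκ) hsμ
  obtain ⟨R, hR, hk⟩ := exists_ae_mem_and_centeredKernel_eq_inner_reducedFeature hac hκ
  obtain ⟨S, hS, hSδ, hexcess⟩ := exists_measurableSet_sum_sq_sub_deviation_le hsμ.orthonormal hFe
    (stronglyMeasurable_reducedFeature hφ stronglyMeasurable_centeredFeature)
    (zero_lt_one.trans_le (one_le_contextComplexity hac hκ))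
    (fun x => (norm_reducedFeature_le hφ x).trans (norm_centeredFeature_le x))
    (reducedOperator_ae_eq hφ) hm hdm hδ0 hδ1
  obtain ⟨T, hTS, hT, hTmass, hTR⟩ := exists_subset_forall_of_ae hS (ae_forall_mem_pi hR)
  refine ⟨T, hT, hTmass ▸ hSδ, fun x hx lam v hv hpos => ?_⟩
  rw [gramMatrix_eq_gram hk (hTR x hx)] at hv
  have hΦ := apply_empiricalEigenvector_ae_eq_kpcaEncoder hR hk (reducedOperator_ae_eq hφ)
    (hTR x hx) hdm lam v
  refine ⟨fun i => ⟨_, (mem_inducedRKHS_iff_mem_range hFe).2 ⟨_, rfl⟩, hΦ i⟩, fun f hf => ?_⟩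
  exact exists_forall_isHkProjection_iff_and_norm_sq_le hsμ.nonneg hsμ.antitone hsμ.orthonormal hFe
    (integral_reducedOperator hφ (integral_centeredFeature hac hκ)) (deviation_nonneg _ _ _ _) hden
    (orthonormal_empiricalEigenvector_castLE hv hdm hpos) (hexcess x (hTS hx) lam v hv hpos) hΦ hε1
    hεs hf
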